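/- Let $(X_t)_{t\ge 0}$ be a Lévy process with values in $\mathbb{R}^n$ (i.e. $X_0=0$ almost surely, the increments are stationary and independent, and almost all paths are right-continuous with finite left-hand limits), and let $\psi:\mathbb{R}^n\to\mathbb{C}$ be its characteristic exponent, i.e. $\mathbb{E}\,e^{i\xi\cdot X_t}=e^{-t\psi(\xi)}$ for all $t\ge 0$ and $\xi\in\mathbb{R}^n$. Let $L_\psi$ be the generator of the process, i.e. the pseudo-differential operator given on rapidly decreasing smooth functions $u$ by $\widehat{L_\psi u}(\xi)=-\psi(\xi)\,\widehat u(\xi)$, where $\widehat u(\xi)=(2\pi)^{-n}\int_{\mathbb{R}^n} e^{-ix\cdot\xi}u(x)\,dx$. For complex-valued $f\in L^\infty(\mathbb{R}^n)$ let $L_\psi f\in\mathcal{D}'(\mathbb{R}^n)$ be the distribution $$\langle L_\psi f,\phi\rangle=\int_{\mathbb{R}^n} f(x)\,L_{\overline\psi}\phi(x)\,dx,\qquad \phi\in C_c^\infty(\mathbb{R}^n).$$ Then: 1. $L_\psi$ has the Liouville property, i.e. every $f\in L^\infty(\mathbb{R}^n)$ with $L_\psi f=0$ in $\mathcal{D}'(\mathbb{R}^n)$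 is almost everywhere equal to a constant, if and only if $\{\psi=0\}=\{0\}$, where $\{\psi=0\}=\{\xi\in\mathbb{R}^n:\psi(\xi)=0\}$. 2. If $\{\psi=0\}\ne\{0\}$, then the solutions $f\in L^\infty(\mathbb{R}^n)$ of $L_\psi f=0$ in $\mathcal{D}'(\mathbb{R}^n)$ are periodic with period group the orthogonal subgroup $$H=\{h\in\mathbb{R}^n: e^{ih\cdot g}=1\text{ for all } g\in\{\psi=0\}\}.$$ That is, for every such $f$ and every $h\in H$ one has $f(x+h)=f(x)$ for almost every $x$; and $H$ is exactly the set of all $h\in\mathbb{R}^n$ which are a period, in this almost everywhere sense, of every such solution. -/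

import Mathlib

open MeasureTheory ProbabilityTheory Filter Topology
open scoped NNReal FourierTransform ComplexConjugate

noncomputable section

namespace LevyLiouville

variable {n : ℕ}

/-- A Lévy process with values in `ℝⁿ`: it starts at `0`, has independent and stationary
increments, and almost all of its paths are right-continuous with finite left-hand limits. -/
structure IsLevyProcess {Ω : Type*} [MeasurableSpace Ω] (P : Measure Ω)
    (X : ℝ≥0 → Ω → EuclideanSpace ℝ (Fin n)) : Prop where
  measurable : ∀ t, Measurable (X t)
  start_zero : ∀ᵐ ω ∂P, X 0 ω = 0
  indep_increments : HasIndepIncrements X P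
  stationary_increments : ∀ s t : ℝ≥0, IdentDistrib (X (s + t) - X s) (X t) P P
  cadlag : ∀ᵐ ω ∂P, ∀ t : ℝ≥0,
    ContinuousWithinAt (fun s => X s ω) (Set.Ici t) t ∧
      ∃ l, Tendsto (fun s => X s ω) (𝓝[<] t) (𝓝 l)

/-- `ψ` is the characteristic exponent of the process `X`:
`E exp(i ξ · X_t) = exp(-t ψ(ξ))` for all `t ≥ 0` and `ξ ∈ ℝⁿ`. -/
def IsCharExponent {Ω : Type*} [MeasurableSpace Ω] (P : Measure Ω)
    (X : ℝ≥0 → Ω → EuclideanSpace ℝ (Fin n)) (ψ : EuclideanSpace ℝ (Fin n) → ℂ) : Prop :=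
  ∀ (t : ℝ≥0) (ξ : EuclideanSpace ℝ (Fin n)),
    ∫ ω, Complex.exp (Complex.I * (inner ℝ ξ (X t ω) : ℝ)) ∂P = Complex.exp (-(t : ℂ) * ψ ξ)

/-- The pseudo-differential operator `L_ψ` with symbol `-ψ`, acting on nice functions `u`:
`L_ψ u (x) = -∫ exp(i x · ξ) ψ(ξ) û(ξ) dξ` with
`û(ξ) = (2π)⁻ⁿ ∫ exp(-i x · ξ) u(x) dx`. Mathlib's Fourier transform has the kernel
`exp(-2π i x · ξ)`, which is why the symbol is evaluated at `2π ξ`. -/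
def levyOp (ψ : EuclideanSpace ℝ (Fin n) → ℂ) (u : EuclideanSpace ℝ (Fin n) → ℂ) :
    EuclideanSpace ℝ (Fin n) → ℂ :=
  𝓕⁻ (fun ξ => -ψ ((2 * Real.pi) • ξ) * 𝓕 u ξ)

/-- Test functions: smooth with compact support. -/
def IsTestFunction (φ : EuclideanSpace ℝ (Fin n) → ℂ) : Prop :=
  ContDiff ℝ (⊤ : ℕ∞) φ ∧ HasCompactSupport φ

/-- The distribution `L_ψ f`, for bounded `f`, evaluated at the test function `φ`:
`⟨L_ψ f, φ⟩ = ⟨f, L_ψ* φ⟩`, where the adjoint `L_ψ*` has the complex conjugate symbol. -/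
def levyPairing (ψ f φ : EuclideanSpace ℝ (Fin n) → ℂ) : ℂ :=
  ∫ x, f x * levyOp (fun ξ => conj (ψ ξ)) φ x

/-- `f` is a bounded solution: `f ∈ L^∞(ℝⁿ)` and `L_ψ f = 0` in the sense of distributions. -/
def IsBoundedSolution (ψ f : EuclideanSpace ℝ (Fin n) → ℂ) : Prop :=
  MemLp f ⊤ volume ∧ ∀ φ, IsTestFunction φ → levyPairing ψ f φ = 0

/-- The Liouville property of `L_ψ`: each bounded solution is (a.e. equal to) a constant. -/
def LiouvilleProperty (ψ : EuclideanSpace ℝ (Fin n) → ℂ) : Prop :=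
  ∀ f, IsBoundedSolution ψ f → ∃ c : ℂ, f =ᵐ[volume] fun _ => c

/-- The zero set of `ψ`. -/
def zeroSet (ψ : EuclideanSpace ℝ (Fin n) → ℂ) : Set (EuclideanSpace ℝ (Fin n)) :=
  {ξ | ψ ξ = 0}

/-- The orthogonal subgroup `{h : exp(i h · g) = 1 for all g ∈ S}`, as a set. -/
def orthogonalSubgroup (S : Set (EuclideanSpace ℝ (Fin n))) : Set (EuclideanSpace ℝ (Fin n)) :=
  {h | ∀ g ∈ S, Complex.exp (Complex.I * (inner ℝ h g : ℝ)) = 1}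

/-- The group of periods of (the a.e.-equivalence class of) `f`, as a set. -/
def periods (f : EuclideanSpace ℝ (Fin n) → ℂ) : Set (EuclideanSpace ℝ (Fin n)) :=
  {h | (fun x => f (x + h)) =ᵐ[volume] f}

end LevyLiouville

end

/-!
The process enters only through its marginals `μ t`, the laws of `X t`, whose characteristic
functions are `exp(-t ψ)` (`HasExponent`). The Laplace transform in `t` shows that `ψ` is continuous
and `ψ (-ξ) = conj (ψ ξ)`, and first order expansion in `t` shows that truncated moments of `μ t`
are `O(t)` and that `ψ` grows at most quadratically.

*The pairing makes sense.* The adjoint generator `adjointOp ψ` maps test functions to integrable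
functions (`HasExponent.integrable_adjointOp`): a second order Taylor expansion and the moment bounds
give `‖P_t φ - φ‖₁ = O(t)` for the adjoint semigroup `P_t φ = ∫ φ (· - y) dμ_t(y)`, the difference
quotients converge pointwise to the adjoint generator, and Fatou's lemma applies.

*Solutions are harmonic.* If `f` is a bounded solution, it has pairing zero with all translates of
`L φ`, hence with their superpositions `P_s L φ`. Integrating Duhamel's formula
`P_t φ - φ = ∫₀ᵗ P_s L φ ds` against `f` shows that `f` has the same pairing with `P_t φ` and with `φ`
(`HasExponent.integral_mul_integral_eq`). So the mollifications of `f` are bounded continuous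
functions which are harmonic for each random walk with step distribution `μ t`.

*Harmonic functions are periodic.* By the Choquet–Deny theorem
(`ae_translate_eq_of_integral_translate_eq`) they are invariant under translation by almost every
step. Therefore every `μ t` is carried by the closed group `G` of translations which leave the
mollifications of `f` invariant. A character which is trivial on `G` has mean one under every `μ t`,
so its frequency is a zero of `ψ`. Duality for closed subgroups of a Euclidean space
(`AddSubgroup.exists_inner_intCast_of_isClosed`) then gives that `G` contains the annihilator of the
zero set of `ψ`.

*Conversely*, each zero `g` of `ψ` gives the bounded solution `exp(i g · x)`, by Fourier inversion
(`HasExponent.integral_exp_mul_adjointOp`). Its periods are the `h` with `exp(i g · h) = 1`, and it is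
constant only if `g = 0`.
-/

set_option linter.unusedSectionVars false

/-! ### Duality for closed subgroups of a Euclidean space -/

section Duality

variable {E : Type*} [NormedAddCommGroup E] [InnerProductSpace ℝ E] [FiniteDimensional ℝ E]

/-- A closed subgroup of a finite-dimensional space which contains no line is discrete: a limit
of directions of ever shorter elements of the subgroup would span a line inside it. -/
theorem AddSubgroup.discreteTopology_of_isClosed_of_forall_smul_mem {Λ : AddSubgroup E}
    (hΛ : IsClosed (Λ : Set E)) (hline : ∀ v : E, (∀ t : ℝ, t • v ∈ Λ) → v = 0) :
    DiscreteTopology Λ := by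
  by_contra hnot
  have hsmall : ∀ k : ℕ, ∃ l ∈ Λ, l ≠ 0 ∧ ‖l‖ < 1 / ((k : ℝ) + 1) := by
    intro k
    by_contra! hk
    refine hnot (discreteTopology_of_isOpen_singleton_zero ?_)
    rw [Metric.isOpen_singleton_iff]
    refine ⟨1 / ((k : ℝ) + 1), by positivity, fun y hy => ?_⟩
    by_contra hy0
    have := hk y y.2 (by simpa using hy0)
    rw [dist_zero_right] at hy
    exact absurd hy (not_lt.2 this)
  choose l hlΛ hl0 hl using hsmall
  have hu : ∀ k, (‖l k‖⁻¹ • l k) ∈ Metric.sphere (0 : E) 1 := by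
    intro k
    simp [norm_smul, inv_mul_cancel₀ (norm_ne_zero_iff.2 (hl0 k))]
  obtain ⟨u, hu1, s, hs, hlim⟩ := (isCompact_sphere (0 : E) 1).tendsto_subseq hu
  have hltend : Tendsto (fun k => ‖l (s k)‖) atTop (𝓝 0) := by
    refine squeeze_zero (fun _ => norm_nonneg _) (fun k => (hl (s k)).le) ?_
    exact (tendsto_one_div_add_atTop_nhds_zero_nat (𝕜 := ℝ)).comp hs.tendsto_atTop
  have hu0 : u = 0 := by
    refine hline u fun t => ?_
    -- `⌊t / ‖l‖⌋ • l` lies in the subgroup and is within `‖l‖` of `t • (l / ‖l‖)`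
    have hfl : Tendsto (fun k => (⌊t * ‖l (s k)‖⁻¹⌋ : ℤ) • l (s k)) atTop (𝓝 (t • u)) := by
      have h2 : Tendsto (fun k => (Int.fract (t * ‖l (s k)‖⁻¹)) • l (s k)) atTop (𝓝 0) := by
        refine squeeze_zero_norm (fun k => ?_) hltend
        rw [norm_smul, Real.norm_of_nonneg (Int.fract_nonneg _)]
        exact mul_le_of_le_one_left (norm_nonneg _) (Int.fract_lt_one _).le
      have h3 := (hlim.const_smul t).sub h2
      rw [sub_zero] at h3
      refine h3.congr fun k => ?_
      simp only [Function.comp_apply, smul_smul, Int.fract, sub_smul, Int.cast_smul_eq_zsmul]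
      abel
    exact hΛ.mem_of_tendsto hfl (Eventually.of_forall fun k => Λ.zsmul_mem (hlΛ _) _)
  simp [hu0] at hu1

/-- A point outside a discrete subgroup is separated from it by a functional which is
integer-valued on the subgroup. -/
theorem AddSubgroup.exists_inner_intCast_of_discrete {Λ : AddSubgroup E} [hd : DiscreteTopology Λ]
    {h : E} (hh : h ∉ Λ) :
    ∃ ξ : E, (∀ g ∈ Λ, ∃ m : ℤ, inner ℝ ξ g = m) ∧ ∀ m : ℤ, inner ℝ ξ h ≠ m := by
  set W : Submodule ℝ E := Submodule.span ℝ (Λ : Set E) with hW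
  by_cases hhW : h ∈ W
  · let L : Submodule ℤ W := Submodule.comap (W.subtype.restrictScalars ℤ) Λ.toIntSubmodule
    have hLmem : ∀ w : W, w ∈ L ↔ (w : E) ∈ Λ := fun w => Iff.rfl
    have hdL : DiscreteTopology L :=
      DiscreteTopology.preimage_of_continuous_injective (Λ : Set E) (f := W.subtype)
        continuous_subtype_val Subtype.val_injective
    have hL : IsZLattice ℝ L := ⟨by
      rw [← (Submodule.map_injective_of_injective W.injective_subtype).eq_iff, Submodule.map_span,
        Submodule.map_top, Submodule.range_subtype]
      change _ = Submodule.span ℝ (Λ : Set E)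
      congr 1
      ext x
      constructor
      · rintro ⟨y, hy, rfl⟩
        exact hy
      · exact fun hx => ⟨⟨x, Submodule.subset_span hx⟩, hx, rfl⟩⟩
    have : Module.Finite ℤ L := ZLattice.module_finite ℝ L
    have : Module.Free ℤ L := ZLattice.module_free ℝ L
    let b := Module.Free.chooseBasis ℤ L
    let B := b.ofZLatticeBasis ℝ L
    -- inside the span, some coordinate in a `ℤ`-basis is not an integer
    have hcoord : ∃ i, ∀ m : ℤ, B.repr ⟨h, hhW⟩ i ≠ m := by
      by_contra! hc
      choose m hm using hc
      refine hh ((hLmem ⟨h, hhW⟩).1 ?_)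
      rw [← B.sum_repr ⟨h, hhW⟩]
      refine L.sum_mem fun i _ => ?_
      rw [hm i, Int.cast_smul_eq_zsmul, b.ofZLatticeBasis_apply ℝ]
      exact L.smul_mem _ (b i).2
    obtain ⟨i, hi⟩ := hcoord
    obtain ⟨η, hη⟩ : ∃ η : E, ∀ w : W, inner ℝ η (w : E) = B.repr w i := by
      refine ⟨((InnerProductSpace.toDual ℝ W).symm
        (LinearMap.toContinuousLinearMap (B.coord i)) : W), fun w => ?_⟩
      rw [← Submodule.coe_inner, InnerProductSpace.toDual_symm_apply]
      simp
    refine ⟨η, fun g hg => ?_, fun m => ?_⟩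
    · refine ⟨b.repr ⟨⟨g, Submodule.subset_span hg⟩, hg⟩ i, ?_⟩
      rw [← b.ofZLatticeBasis_repr_apply ℝ]
      exact hη ⟨g, Submodule.subset_span hg⟩
    · rw [show h = ((⟨h, hhW⟩ : W) : E) from rfl, hη]
      exact hi m
  · -- outside the span, a multiple of the orthogonal component takes the value `1 / 2`
    set r : E := h - W.starProjection h with hr
    have hrW : r ∈ Wᗮ := W.sub_starProjection_mem_orthogonal h
    have hr0 : r ≠ 0 := by
      intro h0
      rw [hr, sub_eq_zero] at h0
      exact hhW (h0 ▸ W.starProjection_apply_mem h)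
    have hrh : inner ℝ r h = ‖r‖ ^ 2 := by
      rw [← real_inner_self_eq_norm_sq, ← sub_eq_zero, ← inner_sub_right]
      rw [show h - r = W.starProjection h by rw [hr]; abel]
      exact W.inner_left_of_mem_orthogonal (W.starProjection_apply_mem h) hrW
    refine ⟨(2 * ‖r‖ ^ 2)⁻¹ • r, fun g hg => ⟨0, ?_⟩, fun m hm => ?_⟩
    · rw [real_inner_smul_left,
        W.inner_left_of_mem_orthogonal (Submodule.subset_span hg) hrW]
      simp
    · rw [real_inner_smul_left, hrh] at hm
      have hn : ‖r‖ ^ 2 ≠ 0 := pow_ne_zero _ (norm_ne_zero_iff.2 hr0)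
      have h2 : (2 * m : ℝ) = 1 := by rw [← hm]; field_simp
      have h3 : 2 * m = 1 := by exact_mod_cast h2
      omega

/-- Duality for closed subgroups: a point outside a closed subgroup is separated from it by a
functional which is integer-valued on the subgroup. The subgroup is the sum of the largest
subspace it contains and of a discrete subgroup orthogonal to that subspace. -/
theorem AddSubgroup.exists_inner_intCast_of_isClosed {G : AddSubgroup E}
    (hG : IsClosed (G : Set E)) {h : E} (hh : h ∉ G) :
    ∃ ξ : E, (∀ g ∈ G, ∃ m : ℤ, inner ℝ ξ g = m) ∧ ∀ m : ℤ, inner ℝ ξ h ≠ m := by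
  let V : Submodule ℝ E :=
    { carrier := {v | ∀ t : ℝ, t • v ∈ G}
      add_mem' := fun {a b} ha hb t => by rw [smul_add]; exact G.add_mem (ha t) (hb t)
      zero_mem' := fun t => by rw [smul_zero]; exact G.zero_mem
      smul_mem' := fun c v hv t => by rw [smul_smul]; exact hv _ }
  have hVG : ∀ v ∈ V, v ∈ G := fun v hv => by simpa using hv 1
  let Λ : AddSubgroup E := G ⊓ Vᗮ.toAddSubgroup
  have hΛ : IsClosed (Λ : Set E) := hG.inter V.isClosed_orthogonal
  have hline : ∀ v : E, (∀ t : ℝ, t • v ∈ Λ) → v = 0 := by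
    intro v hv
    have h1 : v ∈ V := fun t => (hv t).1
    have h2 : v ∈ Vᗮ := by simpa using (hv 1).2
    exact inner_self_eq_zero.1 (V.inner_right_of_mem_orthogonal h1 h2)
  have := AddSubgroup.discreteTopology_of_isClosed_of_forall_smul_mem hΛ hline
  have hk : h - V.starProjection h ∉ Λ := by
    intro hk
    refine hh ?_
    rw [← sub_add_cancel h (V.starProjection h)]
    exact G.add_mem hk.1 (hVG _ (V.starProjection_apply_mem h))
  obtain ⟨ξ, hξ, hξh⟩ := AddSubgroup.exists_inner_intCast_of_discrete hk
  have hswap : ∀ g : E, inner ℝ (ξ - V.starProjection ξ) g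
      = inner ℝ ξ (g - V.starProjection g) := by
    intro g
    rw [inner_sub_left, inner_sub_right, V.inner_starProjection_left_eq_right]
  refine ⟨ξ - V.starProjection ξ, fun g hg => ?_, fun m => ?_⟩
  · rw [hswap]
    exact hξ _ ⟨G.sub_mem hg (hVG _ (V.starProjection_apply_mem g)),
      V.sub_starProjection_mem_orthogonal g⟩
  · rw [hswap]
    exact hξh m

end Duality

/-! ### Bounded harmonic functions of a random walk -/

section ChoquetDeny

variable {E : Type*} [AddCommGroup E] [TopologicalSpace E] [IsTopologicalAddGroup E]
  [SecondCountableTopology E] [MeasurableSpace E] [BorelSpace E]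

/-- The variance identity for a complex-valued bounded random variable. -/
theorem MeasureTheory.integral_norm_sub_integral_sq {α : Type*} [MeasurableSpace α] (μ : Measure α)
    [IsProbabilityMeasure μ] {v : α → ℂ} (hv : AEStronglyMeasurable v μ) {B : ℝ}
    (hB : ∀ y, ‖v y‖ ≤ B) :
    ∫ y, ‖v y - ∫ z, v z ∂μ‖ ^ 2 ∂μ = ∫ y, ‖v y‖ ^ 2 ∂μ - ‖∫ z, v z ∂μ‖ ^ 2 := by
  set c := ∫ z, v z ∂μ with hc
  have hvi : Integrable v μ := .of_bound hv B (.of_forall hB)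
  have hv2 : Integrable (fun y => ‖v y‖ ^ 2) μ := by
    refine .of_bound (hv.norm.pow 2) (B ^ 2) (.of_forall fun y => ?_)
    rw [Real.norm_of_nonneg (by positivity)]
    exact pow_le_pow_left₀ (norm_nonneg _) (hB y) 2
  have hin : Integrable (fun y => inner ℝ c (v y)) μ := hvi.const_inner c
  have h1 : ∀ y, ‖v y - c‖ ^ 2 = ‖v y‖ ^ 2 - 2 * inner ℝ c (v y) + ‖c‖ ^ 2 := by
    intro y
    rw [norm_sub_sq_real, real_inner_comm]
  have hsub : Integrable (fun y => ‖v y‖ ^ 2 - 2 * inner ℝ c (v y)) μ := hv2.sub (hin.const_mul 2)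
  simp_rw [h1]
  rw [integral_add hsub (integrable_const _),
    integral_sub hv2 (hin.const_mul 2), integral_const_mul, integral_inner hvi, ← hc,
    real_inner_self_eq_norm_sq]
  simp
  ring

/-- **Choquet–Deny theorem**: a bounded continuous function which is harmonic for the random walk
with step distribution `μ` is invariant under translation by `μ`-almost every step.

With `P a x = ∫ a (x + y) dμ(y)` and `a = ‖u‖²`, harmonicity gives that
`g = P a - a = ∫ ‖u (· + y) - u‖² dμ(y)` satisfies `0 ≤ g ≤ P g`, the differences of `u` being
harmonic as well. Hence `a + N g ≤ sup a` for each `N`, and `g = 0`. -/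
theorem ae_translate_eq_of_integral_translate_eq {μ : Measure E} [IsProbabilityMeasure μ]
    {u : E → ℂ} (hu : Continuous u) {B : ℝ} (hB : ∀ x, ‖u x‖ ≤ B)
    (hharm : ∀ x, ∫ y, u (x + y) ∂μ = u x) (x : E) : ∀ᵐ y ∂μ, u (x + y) = u x := by
  have hB0 : 0 ≤ B := (norm_nonneg _).trans (hB x)
  have hint : ∀ {v : E → ℝ} {b : ℝ}, StronglyMeasurable v → (∀ y, ‖v y‖ ≤ b) → Integrable v μ :=
    fun hv hb => .of_bound hv.aestronglyMeasurable _ (.of_forall hb)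
  have hd2 : ∀ x y, ‖u (x + y) - u x‖ ^ 2 ≤ (B + B) ^ 2 := fun x y =>
    pow_le_pow_left₀ (norm_nonneg _) ((norm_sub_le _ _).trans (add_le_add (hB _) (hB _))) 2
  set a : E → ℝ := fun x => ‖u x‖ ^ 2 with ha
  set g : E → ℝ := fun x => ∫ y, ‖u (x + y) - u x‖ ^ 2 ∂μ with hg
  have hgm : StronglyMeasurable g := by
    refine StronglyMeasurable.integral_prod_right'
      (f := fun p : E × E => ‖u (p.1 + p.2) - u p.1‖ ^ 2) ?_
    exact Continuous.stronglyMeasurable (by fun_prop)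
  have hg0 : ∀ x, 0 ≤ g x := fun x => integral_nonneg fun y => by positivity
  have hgB : ∀ x, ‖g x‖ ≤ (B + B) ^ 2 := by
    intro x
    refine (norm_integral_le_of_norm_le_const (.of_forall fun y => ?_)).trans_eq
      (by rw [probReal_univ, mul_one])
    rw [Real.norm_of_nonneg (by positivity)]
    exact hd2 x y
  have hga : ∀ x, a x + g x = ∫ y, a (x + y) ∂μ := by
    intro x
    have := MeasureTheory.integral_norm_sub_integral_sq μ (v := fun y => u (x + y))
      (Continuous.aestronglyMeasurable (by fun_prop)) (fun y => hB _)
    rw [hharm] at this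
    simp only [ha, hg, this]
    ring
  have hgP : ∀ x, g x ≤ ∫ z, g (x + z) ∂μ := by
    intro x
    have hswap : ∫ z, g (x + z) ∂μ
        = ∫ y, ∫ z, ‖u (x + z + y) - u (x + z)‖ ^ 2 ∂μ ∂μ := by
      simp only [hg]
      refine integral_integral_swap (f := fun z y => ‖u (x + z + y) - u (x + z)‖ ^ 2) ?_
      refine .of_bound (C := (B + B) ^ 2) ?_ (.of_forall fun p => ?_)
      · exact Continuous.aestronglyMeasurable (by unfold Function.uncurry; fun_prop)
      · rw [Real.norm_of_nonneg (by unfold Function.uncurry; positivity)]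
        exact hd2 _ _
    rw [hswap]
    refine integral_mono (hint (Continuous.stronglyMeasurable (by fun_prop)) (b := (B + B) ^ 2)
      fun y => ?_) (hint (b := (B + B) ^ 2) ?_ fun y => ?_) fun y => ?_
    · rw [Real.norm_of_nonneg (by positivity)]
      exact hd2 x y
    · refine StronglyMeasurable.integral_prod_right'
        (f := fun p : E × E => ‖u (x + p.2 + p.1) - u (x + p.2)‖ ^ 2) ?_
      exact Continuous.stronglyMeasurable (by fun_prop)
    · refine (norm_integral_le_of_norm_le_const (.of_forall fun z => ?_)).trans_eq
        (by rw [probReal_univ, mul_one])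
      rw [Real.norm_of_nonneg (by positivity)]
      exact hd2 _ y
    · have h1 : ∫ z, (u (x + z + y) - u (x + z)) ∂μ = u (x + y) - u x := by
        rw [integral_sub, hharm]
        · simp_rw [add_right_comm x _ y]
          rw [hharm]
        · exact .of_bound (Continuous.aestronglyMeasurable (by fun_prop)) B (.of_forall fun _ => hB _)
        · exact .of_bound (Continuous.aestronglyMeasurable (by fun_prop)) B (.of_forall fun _ => hB _)
      have h2 := MeasureTheory.integral_norm_sub_integral_sq μ
        (v := fun z => u (x + z + y) - u (x + z)) (B := B + B)
        (Continuous.aestronglyMeasurable (by fun_prop))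
        (fun z => (norm_sub_le _ _).trans (add_le_add (hB _) (hB _)))
      rw [h1] at h2
      have h3 : 0 ≤ ∫ z, ‖u (x + z + y) - u (x + z) - (u (x + y) - u x)‖ ^ 2 ∂μ :=
        integral_nonneg fun z => by positivity
      simp only
      linarith
  have hbound : ∀ N : ℕ, ∀ x, a x + N * g x ≤ B ^ 2 := by
    intro N
    induction N with
    | zero =>
      intro x
      simpa [ha] using pow_le_pow_left₀ (norm_nonneg _) (hB x) 2
    | succ N ih =>
      intro x
      have hai : Integrable (fun y => a (x + y)) μ := by
        refine hint (b := B ^ 2) (Continuous.stronglyMeasurable (by fun_prop)) fun y => ?_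
        rw [Real.norm_of_nonneg (by positivity)]
        exact pow_le_pow_left₀ (norm_nonneg _) (hB _) 2
      have hgi : Integrable (fun y => g (x + y)) μ :=
        hint (hgm.comp_measurable (measurable_const_add x)) fun y => hgB _
      calc a x + (N + 1 : ℕ) * g x = (a x + g x) + N * g x := by push_cast; ring
        _ ≤ ∫ y, a (x + y) ∂μ + N * ∫ y, g (x + y) ∂μ := by
          rw [hga]
          gcongr
          exact hgP x
        _ = ∫ y, (a (x + y) + N * g (x + y)) ∂μ := by
          rw [integral_add hai (hgi.const_mul _), integral_const_mul]
        _ ≤ ∫ _, B ^ 2 ∂μ := integral_mono (hai.add (hgi.const_mul _)) (integrable_const _)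
          fun y => ih _
        _ = B ^ 2 := by simp
  have hgx : g x = 0 := by
    refine le_antisymm (le_of_not_gt fun hpos => ?_) (hg0 x)
    obtain ⟨N, hN⟩ := exists_nat_gt (B ^ 2 / g x)
    rw [div_lt_iff₀ hpos] at hN
    have h1 := hbound N x
    have h2 : 0 ≤ a x := by positivity
    linarith
  have hi : Integrable (fun y => ‖u (x + y) - u x‖ ^ 2) μ :=
    hint (Continuous.stronglyMeasurable (by fun_prop)) (b := (B + B) ^ 2) fun y => by
      rw [Real.norm_of_nonneg (by positivity)]
      exact hd2 x y
  filter_upwards [(integral_eq_zero_iff_of_nonneg (fun y => by positivity) hi).1 hgx] with y hy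
  have : ‖u (x + y) - u x‖ ^ 2 = 0 := hy
  exact sub_eq_zero.1 (norm_eq_zero.1 (pow_eq_zero_iff two_ne_zero |>.1 this))

end ChoquetDeny

/-! ### The characteristic exponent -/

namespace LevyLiouville

/-- `∫₀ᵗ (-z) exp(-s z) ds = exp(-t z) - 1`. -/
theorem intervalIntegral_neg_mul_exp (z : ℂ) (t : ℝ) :
    ∫ s in (0 : ℝ)..t, -z * Complex.exp (-(s : ℂ) * z) = Complex.exp (-(t : ℂ) * z) - 1 := by
  have hder : ∀ s ∈ Set.uIcc (0 : ℝ) t,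
      HasDerivAt (fun s : ℝ => Complex.exp (-(s : ℂ) * z)) (-z * Complex.exp (-(s : ℂ) * z)) s := by
    intro s _
    have h1 : HasDerivAt (fun s : ℝ => -(s : ℂ) * z) (-1 * z) s :=
      ((Complex.ofRealCLM.hasDerivAt (x := s)).neg).mul_const z
    convert! h1.cexp using 1
    ring
  rw [intervalIntegral.integral_eq_sub_of_hasDerivAt hder]
  · simp
  · exact Continuous.intervalIntegrable (by fun_prop) _ _

theorem norm_exp_neg_mul_le_one {z : ℂ} (hz : 0 ≤ z.re) {t : ℝ} (ht : 0 ≤ t) :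
    ‖Complex.exp (-(t : ℂ) * z)‖ ≤ 1 := by
  rw [Complex.norm_exp, Real.exp_le_one_iff]
  simp only [neg_mul, Complex.neg_re, Complex.re_ofReal_mul, Left.neg_nonpos_iff]
  positivity

theorem norm_exp_neg_mul_sub_one_le {z : ℂ} (hz : 0 ≤ z.re) {t : ℝ} (ht : 0 ≤ t) :
    ‖Complex.exp (-(t : ℂ) * z) - 1‖ ≤ t * ‖z‖ := by
  rw [← intervalIntegral_neg_mul_exp]
  refine (intervalIntegral.norm_integral_le_of_norm_le_const (C := ‖z‖) fun s hs => ?_).trans_eq ?_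
  · rw [Set.uIoc_of_le ht] at hs
    rw [norm_mul, norm_neg]
    exact mul_le_of_le_one_right (norm_nonneg _) (norm_exp_neg_mul_le_one hz hs.1.le)
  · rw [sub_zero, abs_of_nonneg ht, mul_comm]

theorem tendsto_exp_neg_mul_sub_one_div (z : ℂ) :
    Tendsto (fun k : ℕ => ((k : ℂ) + 1) * (Complex.exp (-((1 / ((k : ℝ) + 1) : ℝ) : ℂ) * z) - 1))
      atTop (𝓝 (-z)) := by
  have hder : HasDerivAt (fun s : ℝ => Complex.exp (-(s : ℂ) * z)) (-z) 0 := by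
    have h1 : HasDerivAt (fun s : ℝ => -(s : ℂ) * z) (-1 * z) 0 :=
      ((Complex.ofRealCLM.hasDerivAt (x := 0)).neg).mul_const z
    convert! h1.cexp using 1
    simp
  have h := hder.tendsto_slope_zero_right
  have hk : Tendsto (fun k : ℕ => (1 / ((k : ℝ) + 1) : ℝ)) atTop (𝓝[>] 0) :=
    tendsto_nhdsWithin_iff.2 ⟨tendsto_one_div_add_atTop_nhds_zero_nat,
      .of_forall fun k => by simp only [Set.mem_Ioi]; positivity⟩
  refine (h.comp hk).congr fun k => ?_
  simp

theorem abs_sin_sub_self_le (s : ℝ) : |Real.sin s - s| ≤ 2 * s ^ 2 := by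
  rcases le_or_gt |s| 1 with h | h
  · have h1 := Real.sin_bound h
    have h2 : |Real.sin s - s| ≤ |Real.sin s - (s - s ^ 3 / 6)| + |s ^ 3 / 6| := by
      refine le_trans (le_of_eq ?_) (abs_sub _ _)
      congr 1
      ring
    have h3 : |s ^ 3 / 6| = |s| ^ 3 / 6 := by rw [abs_div, abs_pow]; norm_num
    have h4 : |s| ^ 3 ≤ |s| ^ 2 := pow_le_pow_of_le_one (abs_nonneg _) h (by norm_num)
    have h5 : |s| ^ 5 ≤ |s| ^ 2 := pow_le_pow_of_le_one (abs_nonneg _) h (by norm_num)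
    have h6 : 0 ≤ |s| ^ 2 := by positivity
    rw [← sq_abs s]
    linarith
  · have h1 : |Real.sin s - s| ≤ |Real.sin s| + |s| := abs_sub _ _
    have h2 := Real.abs_sin_le_one s
    rw [← sq_abs s]
    nlinarith

theorem norm_exp_mul_I_sub_one_sub_le (s : ℝ) :
    ‖Complex.exp (s * Complex.I) - 1 - s * Complex.I‖ ≤ 3 * s ^ 2 := by
  have h1 : Complex.exp (s * Complex.I) - 1 - s * Complex.I
      = ((Real.cos s - 1 : ℝ) : ℂ) + ((Real.sin s - s : ℝ) : ℂ) * Complex.I := by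
    rw [Complex.exp_mul_I]
    push_cast
    ring
  rw [h1]
  refine (norm_add_le _ _).trans ?_
  rw [norm_mul, Complex.norm_I, mul_one, Complex.norm_real, Complex.norm_real, Real.norm_eq_abs,
    Real.norm_eq_abs, abs_of_nonpos (sub_nonpos.2 (Real.cos_le_one s))]
  have h2 := Real.one_sub_sq_div_two_le_cos (x := s)
  have h3 := abs_sin_sub_self_le s
  nlinarith [sq_nonneg s]

variable {E : Type*} [NormedAddCommGroup E] [InnerProductSpace ℝ E] [FiniteDimensional ℝ E]
  [MeasurableSpace E] [BorelSpace E]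

/-- The probability measures `μ t` have the characteristic functions `exp(-t ψ)`: they are the
one-dimensional marginals of a Lévy process with exponent `ψ`. -/
structure HasExponent (μ : ℝ≥0 → Measure E) (ψ : E → ℂ) : Prop where
  isProbabilityMeasure : ∀ t, IsProbabilityMeasure (μ t)
  charFun_eq : ∀ t ξ, charFun (μ t) ξ = Complex.exp (-(t : ℂ) * ψ ξ)

namespace HasExponent

variable {μ : ℝ≥0 → Measure E} {ψ : E → ℂ}

theorem re_nonneg (h : HasExponent μ ψ) (ξ : E) : 0 ≤ (ψ ξ).re := by
  have := h.isProbabilityMeasure 1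
  have h1 := norm_charFun_le_one (μ := μ 1) ξ
  rw [h.charFun_eq, Complex.norm_exp, Real.exp_le_one_iff] at h1
  simpa using h1

theorem norm_charFun_sub_one_le (h : HasExponent μ ψ) (t : ℝ≥0) (ξ : E) :
    ‖charFun (μ t) ξ - 1‖ ≤ t * ‖ψ ξ‖ := by
  rw [h.charFun_eq]
  exact norm_exp_neg_mul_sub_one_le (h.re_nonneg ξ) t.2

/-- The Laplace transform in time recovers the exponent from the characteristic functions without
any choice of a branch of the logarithm. -/
theorem integral_exp_neg_mul_charFun (h : HasExponent μ ψ) (ξ : E) :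
    ∫ t in Set.Ioi (0 : ℝ), Complex.exp (-t) * charFun (μ t.toNNReal) ξ = (1 + ψ ξ)⁻¹ := by
  have h1 : (-(1 + ψ ξ)).re < 0 := by
    have := h.re_nonneg ξ
    simp only [Complex.neg_re, Complex.add_re, Complex.one_re]
    linarith
  have h2 := integral_exp_mul_complex_Ioi h1 0
  rw [Complex.ofReal_zero, mul_zero, Complex.exp_zero, neg_div_neg_eq, one_div] at h2
  rw [← h2]
  refine setIntegral_congr_fun measurableSet_Ioi fun t ht => ?_
  rw [h.charFun_eq, ← Complex.exp_add, Real.coe_toNNReal t (le_of_lt ht)]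
  congr 1
  ring

theorem eq_inv_integral_sub_one (h : HasExponent μ ψ) (ξ : E) :
    ψ ξ = (∫ t in Set.Ioi (0 : ℝ), Complex.exp (-t) * charFun (μ t.toNNReal) ξ)⁻¹ - 1 := by
  rw [h.integral_exp_neg_mul_charFun, inv_inv]
  ring

/-- The Laplace transform is continuous by dominated convergence, and `1 + ψ` is its inverse. -/
theorem continuous (h : HasExponent μ ψ) : Continuous ψ := by
  have hne : ∀ ξ, 1 + ψ ξ ≠ 0 := by
    intro ξ h0
    have h1 := h.re_nonneg ξ
    have h2 := congrArg Complex.re h0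
    simp only [Complex.add_re, Complex.one_re, Complex.zero_re] at h2
    linarith
  have hcont : Continuous fun ξ =>
      ∫ t in Set.Ioi (0 : ℝ), Complex.exp (-t) * charFun (μ t.toNNReal) ξ := by
    refine continuous_of_dominated (bound := fun t => Real.exp (-t)) (fun ξ => ?_) (fun ξ => ?_)
      ?_ (.of_forall fun t => ?_)
    · have : ∀ t : ℝ, charFun (μ t.toNNReal) ξ
          = Complex.exp (-((t.toNNReal : ℝ) : ℂ) * ψ ξ) := fun t => h.charFun_eq _ _
      simp_rw [this]
      exact Continuous.aestronglyMeasurable (by fun_prop)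
    · refine .of_forall fun t => ?_
      have := h.isProbabilityMeasure t.toNNReal
      rw [norm_mul, Complex.norm_exp, Complex.neg_re, Complex.ofReal_re]
      exact mul_le_of_le_one_right (Real.exp_pos _).le (norm_charFun_le_one _)
    · exact integrableOn_exp_neg_Ioi 0
    · have := h.isProbabilityMeasure t.toNNReal
      exact continuous_const.mul continuous_charFun
  have heq : ψ = fun ξ =>
      (∫ t in Set.Ioi (0 : ℝ), Complex.exp (-t) * charFun (μ t.toNNReal) ξ)⁻¹ - 1 :=
    funext h.eq_inv_integral_sub_one
  rw [heq]
  refine (hcont.inv₀ fun ξ => ?_).sub continuous_const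
  rw [h.integral_exp_neg_mul_charFun]
  exact inv_ne_zero (hne ξ)

theorem eq_of_charFun_eq (h : HasExponent μ ψ) {μ' : ℝ≥0 → Measure E} {ψ' : E → ℂ}
    (h' : HasExponent μ' ψ') {ξ ξ' : E} (heq : ∀ t, charFun (μ t) ξ = charFun (μ' t) ξ') :
    ψ ξ = ψ' ξ' := by
  rw [h.eq_inv_integral_sub_one, h'.eq_inv_integral_sub_one]
  simp_rw [heq]

theorem map_zero (h : HasExponent μ ψ) : ψ 0 = 0 := by
  rw [h.eq_inv_integral_sub_one]
  have h1 : ∀ t, charFun (μ t) 0 = 1 := fun t => by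
    have := h.isProbabilityMeasure t
    simp
  have h2 := integral_exp_mul_complex_Ioi (a := -1) (by simp) 0
  simp_rw [h1]
  simp at h2 ⊢
  rw [h2]
  simp

theorem eq_zero_of_charFun_eq_one (h : HasExponent μ ψ) {ξ : E}
    (h1 : ∀ t, charFun (μ t) ξ = 1) : ψ ξ = 0 := by
  rw [← h.map_zero]
  refine h.eq_of_charFun_eq h fun t => ?_
  have := h.isProbabilityMeasure t
  simp [h1]

theorem map_neg (h : HasExponent μ ψ) (ξ : E) : ψ (-ξ) = conj (ψ ξ) := by
  rw [h.eq_inv_integral_sub_one, h.eq_inv_integral_sub_one ξ, map_sub, map_inv₀, map_one,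
    ← integral_conj]
  simp_rw [charFun_neg, map_mul, ← Complex.exp_conj]
  simp

end HasExponent

/-! ### Truncated moments of the marginals -/

/-- The truncation `∑ᵢ sin(yᵢ) eᵢ` of the identity map of `E` to a bounded one: it agrees with `y`
to second order at `0`, and its mean is a combination of values of the characteristic function. -/
noncomputable def sinTrunc (y : E) : E :=
  ∑ i, Real.sin (inner ℝ (stdOrthonormalBasis ℝ E i) y) • stdOrthonormalBasis ℝ E i

theorem continuous_sinTrunc : Continuous (sinTrunc (E := E)) := by
  unfold sinTrunc
  fun_prop

theorem norm_sinTrunc_le (y : E) : ‖sinTrunc y‖ ≤ Module.finrank ℝ E := by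
  refine (norm_sum_le_of_le (f := fun i => Real.sin (inner ℝ (stdOrthonormalBasis ℝ E i) y) •
    stdOrthonormalBasis ℝ E i) Finset.univ (n := fun _ => 1) fun i _ => ?_).trans_eq (by simp)
  rw [norm_smul, OrthonormalBasis.norm_eq_one, mul_one]
  exact Real.abs_sin_le_one _

theorem norm_sinTrunc_sub_le (y : E) : ‖sinTrunc y - y‖ ≤ 2 * ‖y‖ ^ 2 := by
  have h1 : sinTrunc y - y = ∑ i, (Real.sin (inner ℝ (stdOrthonormalBasis ℝ E i) y)
      - inner ℝ (stdOrthonormalBasis ℝ E i) y) • stdOrthonormalBasis ℝ E i := by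
    simp_rw [sub_smul, Finset.sum_sub_distrib]
    rw [(stdOrthonormalBasis ℝ E).sum_repr' y, sinTrunc]
  rw [h1, ← (stdOrthonormalBasis ℝ E).sum_sq_inner_right y, Finset.mul_sum]
  refine norm_sum_le_of_le _ fun i _ => ?_
  rw [norm_smul, OrthonormalBasis.norm_eq_one, mul_one]
  exact abs_sin_sub_self_le _

/-- The Lévy–Khintchine integrand of the exponent, compensated by `sinTrunc`, is of second order
at the origin. -/
theorem norm_exp_inner_sub_one_sub_le (y ξ : E) :
    ‖Complex.exp (inner ℝ y ξ * Complex.I) - 1 - inner ℝ (sinTrunc y) ξ * Complex.I‖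
      ≤ (5 + Module.finrank ℝ E) * (1 + ‖ξ‖ ^ 2) * min 1 (‖y‖ ^ 2) := by
  have hξ : ‖ξ‖ ≤ 1 + ‖ξ‖ ^ 2 := by nlinarith [sq_nonneg (‖ξ‖ - 1)]
  have hd : (0 : ℝ) ≤ Module.finrank ℝ E := by positivity
  rcases le_or_gt ‖y‖ 1 with hy | hy
  · rw [min_eq_right (pow_le_one₀ (norm_nonneg _) hy)]
    have h1 := norm_exp_mul_I_sub_one_sub_le (inner ℝ y ξ)
    have h2 : (inner ℝ y ξ) ^ 2 ≤ (‖y‖ * ‖ξ‖) ^ 2 := by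
      rw [← sq_abs]
      exact pow_le_pow_left₀ (abs_nonneg _) (abs_real_inner_le_norm y ξ) 2
    have h3 : ‖(inner ℝ y ξ * Complex.I : ℂ) - inner ℝ (sinTrunc y) ξ * Complex.I‖
        ≤ 2 * ‖y‖ ^ 2 * ‖ξ‖ := by
      rw [← sub_mul, norm_mul, Complex.norm_I, mul_one, ← Complex.ofReal_sub, Complex.norm_real,
        ← inner_sub_left, ← norm_neg, ← inner_neg_left, neg_sub]
      exact (abs_real_inner_le_norm _ _).trans (by gcongr; exact norm_sinTrunc_sub_le y)
    calc _ ≤ 3 * (‖y‖ * ‖ξ‖) ^ 2 + 2 * ‖y‖ ^ 2 * ‖ξ‖ := by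
          refine (norm_sub_le_norm_sub_add_norm_sub _ (inner ℝ y ξ * Complex.I : ℂ) _).trans ?_
          exact add_le_add (h1.trans (by linarith)) h3
      _ ≤ 3 * (‖y‖ ^ 2 * (1 + ‖ξ‖ ^ 2)) + 2 * (‖y‖ ^ 2 * (1 + ‖ξ‖ ^ 2)) := by
          have := sq_nonneg ‖y‖
          rw [mul_pow, mul_assoc 2]
          gcongr
          linarith
      _ ≤ _ := by
          have : 0 ≤ Module.finrank ℝ E * (‖y‖ ^ 2 * (1 + ‖ξ‖ ^ 2)) := by positivity
          linarith
  · rw [min_eq_left (one_le_pow₀ hy.le), mul_one]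
    have h1 : ‖(inner ℝ (sinTrunc y) ξ * Complex.I : ℂ)‖ ≤ Module.finrank ℝ E * ‖ξ‖ := by
      rw [norm_mul, Complex.norm_I, mul_one, Complex.norm_real]
      exact (abs_real_inner_le_norm _ _).trans (by gcongr; exact norm_sinTrunc_le y)
    have h2 : ‖Complex.exp (inner ℝ y ξ * Complex.I) - 1‖ ≤ 2 := by
      refine (norm_sub_le _ _).trans ?_
      rw [Complex.norm_exp_ofReal_mul_I, norm_one]
      norm_num
    calc _ ≤ 2 + Module.finrank ℝ E * ‖ξ‖ := (norm_sub_le _ _).trans (add_le_add h2 h1)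
      _ ≤ 2 * (1 + ‖ξ‖ ^ 2) + Module.finrank ℝ E * (1 + ‖ξ‖ ^ 2) := by
          gcongr
          nlinarith [sq_nonneg ‖ξ‖]
      _ ≤ _ := by nlinarith [sq_nonneg ‖ξ‖]

theorem min_one_norm_sq_le_sum (y : E) :
    min 1 (‖y‖ ^ 2) ≤ ∑ i, min 1 ((inner ℝ (stdOrthonormalBasis ℝ E i) y) ^ 2) := by
  by_cases h : ∃ i, 1 ≤ (inner ℝ (stdOrthonormalBasis ℝ E i) y) ^ 2
  · obtain ⟨i, hi⟩ := h
    refine (min_le_left _ _).trans ((min_eq_left hi).symm.le.trans ?_)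
    exact Finset.single_le_sum
      (f := fun i => min 1 ((inner ℝ (stdOrthonormalBasis ℝ E i) y) ^ 2))
      (fun j _ => le_min zero_le_one (sq_nonneg _)) (Finset.mem_univ i)
  · push Not at h
    refine (min_le_right _ _).trans_eq ?_
    rw [← (stdOrthonormalBasis ℝ E).sum_sq_inner_right y]
    exact Finset.sum_congr rfl fun i _ => (min_eq_right (h i).le).symm

namespace HasExponent

variable {μ : ℝ≥0 → Measure E} {ψ : E → ℂ}

/-- The part with `1 < |⟪a, y⟫|` is estimated by the tail bound in terms of the characteristic
function, and the rest by `s² ≤ 5 (1 - cos s)` for `|s| ≤ 1`. -/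
theorem integral_min_one_inner_sq_le (h : HasExponent μ ψ) (a : E) :
    ∃ C, 0 ≤ C ∧ ∀ t : ℝ≥0, ∫ y, min 1 ((inner ℝ a y) ^ 2) ∂(μ t) ≤ C * t := by
  obtain ⟨M, hM⟩ := (isCompact_Icc (a := (-2 : ℝ)) (b := 2)).exists_bound_of_continuousOn
    (f := fun s => ψ (s • a)) (h.continuous.comp (by fun_prop)).continuousOn
  have hM0 : 0 ≤ M := (norm_nonneg _).trans (hM 0 (by norm_num))
  refine ⟨2 * M + 5 * ‖ψ a‖, by positivity, fun t => ?_⟩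
  have := h.isProbabilityMeasure t
  have htail : (μ t).real {y | 1 < |inner ℝ a y|} ≤ 2 * M * t := by
    refine (measureReal_abs_inner_gt_le_integral_charFun one_pos).trans ?_
    have : ‖∫ s in (-2 * (1 : ℝ)⁻¹)..(2 * (1 : ℝ)⁻¹), 1 - charFun (μ t) (s • a)‖
        ≤ (t * M) * |2 * (1 : ℝ)⁻¹ - (-2 * (1 : ℝ)⁻¹)| := by
      refine intervalIntegral.norm_integral_le_of_norm_le_const fun s hs => ?_
      rw [Set.uIoc_of_le (by norm_num)] at hs
      rw [norm_sub_rev]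
      refine (h.norm_charFun_sub_one_le t _).trans ?_
      gcongr
      exact hM s ⟨by linarith [hs.1], by linarith [hs.2]⟩
    norm_num at this ⊢
    linarith
  have hcos : ∫ y, (1 - Real.cos (inner ℝ a y)) ∂(μ t) ≤ ‖ψ a‖ * t := by
    have hi : Integrable (fun y => Complex.exp (inner ℝ y a * Complex.I)) (μ t) :=
      .of_bound (Continuous.aestronglyMeasurable (by fun_prop)) 1
        (.of_forall fun y => by rw [Complex.norm_exp_ofReal_mul_I])
    have h1 : ∫ y, Real.cos (inner ℝ a y) ∂(μ t) = (charFun (μ t) a).re := by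
      rw [charFun_apply, ← RCLike.re_eq_complex_re, ← integral_re hi]
      refine integral_congr_ae (.of_forall fun y => ?_)
      simp only [RCLike.re_eq_complex_re, Complex.exp_ofReal_mul_I_re, real_inner_comm]
    have hci : Integrable (fun y => Real.cos (inner ℝ a y)) (μ t) :=
      .of_bound (Continuous.aestronglyMeasurable (by fun_prop)) 1
        (.of_forall fun y => Real.abs_cos_le_one _)
    rw [integral_sub (integrable_const _) hci, h1]
    have h2 := (Complex.abs_re_le_norm _).trans (h.norm_charFun_sub_one_le t a)
    have h3 := neg_le_abs (charFun (μ t) a - 1).re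
    simp only [Complex.sub_re, Complex.one_re] at h2 h3
    simp only [integral_const, probReal_univ, smul_eq_mul, mul_one]
    linarith
  have hmeas : MeasurableSet {y : E | 1 < |inner ℝ a y|} :=
    (isOpen_lt continuous_const (by fun_prop)).measurableSet
  have hind : Integrable ({y : E | 1 < |inner ℝ a y|}.indicator (fun _ => (1 : ℝ))) (μ t) :=
    (integrable_const _).indicator hmeas
  have hci : Integrable (fun y => 1 - Real.cos (inner ℝ a y)) (μ t) := by
    refine (integrable_const _).sub ?_
    exact .of_bound (Continuous.aestronglyMeasurable (by fun_prop)) 1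
        (.of_forall fun y => Real.abs_cos_le_one _)
  calc ∫ y, min 1 ((inner ℝ a y) ^ 2) ∂(μ t)
      ≤ ∫ y, ({y : E | 1 < |inner ℝ a y|}.indicator (fun _ => (1 : ℝ)) y
          + 5 * (1 - Real.cos (inner ℝ a y))) ∂(μ t) := by
        refine integral_mono ?_ (hind.add (hci.const_mul 5)) fun y => ?_
        · refine .of_bound (Continuous.aestronglyMeasurable (by fun_prop)) 1
            (.of_forall fun y => ?_)
          rw [Real.norm_of_nonneg (le_min zero_le_one (sq_nonneg _))]
          exact min_le_left _ _
        · by_cases hy : 1 < |inner ℝ a y|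
          · simp only [Set.indicator, Set.mem_ofPred_eq, hy, if_true]
            have := Real.cos_le_one (inner ℝ a y)
            exact (min_le_left _ _).trans (by linarith)
          · simp only [Set.indicator, Set.mem_ofPred_eq, hy, if_false, zero_add]
            refine (min_le_right _ _).trans ?_
            have h1 := Real.cos_le_one_sub_mul_cos_sq (x := inner ℝ a y)
              ((not_lt.1 hy).trans (by linarith [Real.pi_gt_three]))
            have h2 : 2 / Real.pi ^ 2 ≥ 1 / 5 := by
              rw [ge_iff_le, div_le_div_iff₀ (by norm_num) (by positivity)]
              nlinarith [Real.pi_lt_d2, Real.pi_gt_three]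
            nlinarith [sq_nonneg (inner ℝ a y)]
    _ = (μ t).real {y | 1 < |inner ℝ a y|} + 5 * ∫ y, (1 - Real.cos (inner ℝ a y)) ∂(μ t) := by
        rw [integral_add hind (hci.const_mul 5), integral_const_mul, integral_indicator hmeas]
        simp
    _ ≤ 2 * M * t + 5 * (‖ψ a‖ * t) := by gcongr
    _ = _ := by ring

/-- Truncated second moments of the marginals are of order `t`. -/
theorem integral_min_one_norm_sq_le (h : HasExponent μ ψ) :
    ∃ C, 0 ≤ C ∧ ∀ t : ℝ≥0, ∫ y, min 1 (‖y‖ ^ 2) ∂(μ t) ≤ C * t := by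
  choose C hC0 hC using fun i => h.integral_min_one_inner_sq_le (stdOrthonormalBasis ℝ E i)
  refine ⟨∑ i, C i, Finset.sum_nonneg fun i _ => hC0 i, fun t => ?_⟩
  have := h.isProbabilityMeasure t
  have hi : ∀ i, Integrable
      (fun y => min 1 ((inner ℝ (stdOrthonormalBasis ℝ E i) y) ^ 2)) (μ t) := by
    refine fun i => .of_bound (Continuous.aestronglyMeasurable (by fun_prop)) 1
      (.of_forall fun y => ?_)
    rw [Real.norm_of_nonneg (le_min zero_le_one (sq_nonneg _))]
    exact min_le_left _ _
  calc ∫ y, min 1 (‖y‖ ^ 2) ∂(μ t)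
      ≤ ∫ y, ∑ i, min 1 ((inner ℝ (stdOrthonormalBasis ℝ E i) y) ^ 2) ∂(μ t) := by
        refine integral_mono ?_ (integrable_finsetSum _ fun i _ => hi i) min_one_norm_sq_le_sum
        refine .of_bound (Continuous.aestronglyMeasurable (by fun_prop)) 1
          (.of_forall fun y => ?_)
        rw [Real.norm_of_nonneg (le_min zero_le_one (sq_nonneg _))]
        exact min_le_left _ _
    _ = ∑ i, ∫ y, min 1 ((inner ℝ (stdOrthonormalBasis ℝ E i) y) ^ 2) ∂(μ t) :=
        integral_finsetSum _ fun i _ => hi i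
    _ ≤ ∑ i, C i * t := Finset.sum_le_sum fun i _ => hC i t
    _ = _ := by rw [Finset.sum_mul]

theorem integrable_sinTrunc (h : HasExponent μ ψ) (t : ℝ≥0) :
    Integrable (sinTrunc (E := E)) (μ t) := by
  have := h.isProbabilityMeasure t
  exact .of_bound continuous_sinTrunc.aestronglyMeasurable _ (.of_forall norm_sinTrunc_le)

/-- Truncated first moments of the marginals are of order `t`. -/
theorem norm_integral_sinTrunc_le (h : HasExponent μ ψ) :
    ∃ C, 0 ≤ C ∧ ∀ t : ℝ≥0, ‖∫ y, sinTrunc y ∂(μ t)‖ ≤ C * t := by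
  refine ⟨∑ i, ‖ψ (stdOrthonormalBasis ℝ E i)‖, Finset.sum_nonneg fun i _ => norm_nonneg _,
    fun t => ?_⟩
  have := h.isProbabilityMeasure t
  have hsi : ∀ a : E, Integrable (fun y => Real.sin (inner ℝ a y)) (μ t) := fun a =>
    .of_bound (Continuous.aestronglyMeasurable (by fun_prop)) 1
      (.of_forall fun y => Real.abs_sin_le_one _)
  have hsin : ∀ a : E, ‖∫ y, Real.sin (inner ℝ a y) ∂(μ t)‖ ≤ ‖ψ a‖ * t := by
    intro a
    have hi : Integrable (fun y => Complex.exp (inner ℝ y a * Complex.I)) (μ t) :=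
      .of_bound (Continuous.aestronglyMeasurable (by fun_prop)) 1
        (.of_forall fun y => by rw [Complex.norm_exp_ofReal_mul_I])
    have h1 : ∫ y, Real.sin (inner ℝ a y) ∂(μ t) = (charFun (μ t) a - 1).im := by
      rw [Complex.sub_im, Complex.one_im, sub_zero, charFun_apply, ← RCLike.im_eq_complex_im,
        ← integral_im hi]
      refine integral_congr_ae (.of_forall fun y => ?_)
      simp only [RCLike.im_eq_complex_im, Complex.exp_ofReal_mul_I_im, real_inner_comm]
    rw [h1, mul_comm]
    exact (Complex.abs_im_le_norm _).trans (h.norm_charFun_sub_one_le t a)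
  have h2 : ∫ y, sinTrunc y ∂(μ t) = ∑ i, (∫ y, Real.sin
      (inner ℝ (stdOrthonormalBasis ℝ E i) y) ∂(μ t)) • stdOrthonormalBasis ℝ E i := by
    unfold sinTrunc
    rw [integral_finsetSum _ fun i _ => (hsi _).smul_const _]
    exact Finset.sum_congr rfl fun i _ => integral_smul_const _ _
  rw [h2, Finset.sum_mul]
  refine norm_sum_le_of_le _ fun i _ => ?_
  rw [norm_smul, OrthonormalBasis.norm_eq_one, mul_one]
  exact hsin _

/-- The exponent grows at most quadratically. -/
theorem exists_norm_le (h : HasExponent μ ψ) : ∃ C, 0 ≤ C ∧ ∀ ξ, ‖ψ ξ‖ ≤ C * (1 + ‖ξ‖ ^ 2) := by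
  obtain ⟨C₁, hC₁, h₁⟩ := h.integral_min_one_norm_sq_le
  obtain ⟨C₂, hC₂, h₂⟩ := h.norm_integral_sinTrunc_le
  set D : ℝ := (5 + Module.finrank ℝ E) * C₁ + C₂ with hD
  refine ⟨D, by positivity, fun ξ => ?_⟩
  have hξ : ‖ξ‖ ≤ 1 + ‖ξ‖ ^ 2 := by nlinarith [sq_nonneg (‖ξ‖ - 1)]
  have hbound : ∀ t : ℝ≥0, ‖charFun (μ t) ξ - 1‖ ≤ D * (1 + ‖ξ‖ ^ 2) * t := by
    intro t
    have := h.isProbabilityMeasure t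
    have hi : Integrable (fun y => Complex.exp (inner ℝ y ξ * Complex.I)) (μ t) :=
      .of_bound (Continuous.aestronglyMeasurable (by fun_prop)) 1
        (.of_forall fun y => by rw [Complex.norm_exp_ofReal_mul_I])
    have hS : Integrable (fun y => (inner ℝ (sinTrunc y) ξ : ℂ) * Complex.I) (μ t) :=
      (((h.integrable_sinTrunc t).inner_const ξ).ofReal).mul_const _
    have hmin : Integrable (fun y : E => min 1 (‖y‖ ^ 2)) (μ t) := by
      refine .of_bound (Continuous.aestronglyMeasurable (by fun_prop)) 1
        (.of_forall fun y => ?_)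
      rw [Real.norm_of_nonneg (le_min zero_le_one (sq_nonneg _))]
      exact min_le_left _ _
    have hi1 : Integrable (fun y => Complex.exp (inner ℝ y ξ * Complex.I) - 1) (μ t) :=
      hi.sub (integrable_const _)
    have hsplit : charFun (μ t) ξ - 1
        = ∫ y, (Complex.exp (inner ℝ y ξ * Complex.I) - 1
            - inner ℝ (sinTrunc y) ξ * Complex.I) ∂(μ t)
          + (inner ℝ (∫ y, sinTrunc y ∂(μ t)) ξ : ℂ) * Complex.I := by
      rw [integral_sub hi1 hS, integral_sub hi (integrable_const _),
        integral_mul_const, integral_complex_ofReal, real_inner_comm, ← integral_inner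
        (h.integrable_sinTrunc t), charFun_apply]
      simp [real_inner_comm]
    rw [hsplit]
    have hA : ‖∫ y, (Complex.exp (inner ℝ y ξ * Complex.I) - 1
        - inner ℝ (sinTrunc y) ξ * Complex.I) ∂(μ t)‖
        ≤ (5 + Module.finrank ℝ E) * (1 + ‖ξ‖ ^ 2) * (C₁ * t) := by
      refine (norm_integral_le_of_norm_le (hmin.const_mul _)
        (.of_forall fun y => norm_exp_inner_sub_one_sub_le y ξ)).trans ?_
      rw [integral_const_mul]
      gcongr
      exact h₁ t
    have hB : ‖(inner ℝ (∫ y, sinTrunc y ∂(μ t)) ξ : ℂ) * Complex.I‖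
        ≤ C₂ * t * (1 + ‖ξ‖ ^ 2) := by
      rw [norm_mul, Complex.norm_I, mul_one, Complex.norm_real]
      refine (abs_real_inner_le_norm _ _).trans ?_
      gcongr
      exact h₂ t
    refine (norm_add_le_of_le hA hB).trans_eq ?_
    rw [hD]
    ring
  -- the exponent is minus the derivative of the characteristic function at time `0`
  have hlim := (tendsto_exp_neg_mul_sub_one_div (ψ ξ)).norm
  rw [norm_neg] at hlim
  refine le_of_tendsto hlim (.of_forall fun k => ?_)
  have hk : (0 : ℝ) < (k : ℝ) + 1 := by positivity
  have h3 := hbound (Real.toNNReal (1 / ((k : ℝ) + 1)))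
  rw [h.charFun_eq, Real.coe_toNNReal _ (by positivity)] at h3
  have h4 : ‖(k : ℂ) + 1‖ = (k : ℝ) + 1 := by
    rw [← Nat.cast_add_one, Complex.norm_natCast, Nat.cast_add_one]
  rw [norm_mul, h4]
  calc _ ≤ ((k : ℝ) + 1) * (D * (1 + ‖ξ‖ ^ 2) * (1 / ((k : ℝ) + 1))) := by gcongr
    _ = _ := by field_simp

end HasExponent

end LevyLiouville

/-! ### Fourier multipliers of the adjoint semigroup -/

namespace LevyLiouville

variable {E : Type*} [NormedAddCommGroup E] [InnerProductSpace ℝ E] [FiniteDimensional ℝ E]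
  [MeasurableSpace E] [BorelSpace E]

/-- The operator with symbol `-conj ψ`, the adjoint of the generator, on a general Euclidean
space. -/
noncomputable def adjointOp (ψ : E → ℂ) (u : E → ℂ) : E → ℂ :=
  𝓕⁻ (fun ξ => -conj (ψ ((2 * Real.pi) • ξ)) * 𝓕 u ξ)

theorem fourierInv_mul_fourierChar (m : E → ℂ) (x y : E) :
    𝓕⁻ (fun ξ => (Real.fourierChar (-inner ℝ y ξ) : ℂ) * m ξ) x = 𝓕⁻ m (x - y) := by
  rw [Real.fourierInv_eq, Real.fourierInv_eq]
  congr 1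
  ext ξ
  rw [inner_sub_right, sub_eq_add_neg, AddChar.map_add_eq_mul, mul_smul, real_inner_comm y ξ]
  rfl

theorem fourier_comp_sub_right (u : E → ℂ) (y : E) :
    𝓕 (fun x => u (x - y)) = fun ξ => (Real.fourierChar (-inner ℝ y ξ) : ℂ) * 𝓕 u ξ := by
  have := VectorFourier.fourierIntegral_comp_add_right Real.fourierChar volume (innerₗ E) u (-y)
  ext ξ
  have h := congrFun this ξ
  simp only [Function.comp_def, ← sub_eq_add_neg] at h
  change VectorFourier.fourierIntegral _ _ _ _ _ = _
  rw [h]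
  simp [Circle.smul_def, Real.fourier_eq, VectorFourier.fourierIntegral]

theorem adjointOp_comp_sub_right (ψ u : E → ℂ) (y x : E) :
    adjointOp ψ (fun x => u (x - y)) x = adjointOp ψ u (x - y) := by
  unfold adjointOp
  rw [fourier_comp_sub_right, ← fourierInv_mul_fourierChar]
  refine congrArg (fun m : E → ℂ => 𝓕⁻ m x) (funext fun ξ => ?_)
  ring

theorem continuous_fourierChar_comp {α : Type*} [TopologicalSpace α] {f : α → ℝ}
    (hf : Continuous f) : Continuous fun a => Real.fourierChar (f a) :=
  Real.continuous_fourierChar.comp hf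

theorem aestronglyMeasurable_fourierChar_smul {α : Type*} [TopologicalSpace α]
    [MeasurableSpace α] [OpensMeasurableSpace α] [SecondCountableTopology α] {ν : Measure α}
    {f : α → ℝ} (hf : Continuous f) {u : α → ℂ} (hu : AEStronglyMeasurable u ν) :
    AEStronglyMeasurable (fun a => Real.fourierChar (f a) • u a) ν :=
  (continuous_fourierChar_comp hf).aestronglyMeasurable.smul hu

theorem norm_fourierInv_integrand (m : E → ℂ) (x ξ : E) :
    ‖(Real.fourierChar (inner ℝ ξ x) : Circle) • m ξ‖ = ‖m ξ‖ := Circle.norm_smul _ _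

/-- Inverse Fourier transforms of dominated, pointwise convergent families converge. -/
theorem tendsto_fourierInv_of_dominated {m : ℕ → E → ℂ} {m₀ : E → ℂ} {bound : E → ℝ}
    (hm : ∀ k, AEStronglyMeasurable (m k)) (hb : Integrable bound)
    (hmb : ∀ k ξ, ‖m k ξ‖ ≤ bound ξ) (hlim : ∀ ξ, Tendsto (fun k => m k ξ) atTop (𝓝 (m₀ ξ)))
    (x : E) : Tendsto (fun k => 𝓕⁻ (m k) x) atTop (𝓝 (𝓕⁻ m₀ x)) := by
  simp only [Real.fourierInv_eq]
  refine tendsto_integral_of_dominated_convergence bound (fun k => ?_) hb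
    (fun k => .of_forall fun ξ => ?_) (.of_forall fun ξ => (hlim ξ).const_smul _)
  · exact aestronglyMeasurable_fourierChar_smul (by fun_prop)
        (hm k)
  · rw [norm_fourierInv_integrand]
    exact hmb k ξ

theorem integrable_fourier_schwartz (φ : SchwartzMap E ℂ) : Integrable (𝓕 (φ : E → ℂ)) := by
  rw [← SchwartzMap.fourier_coe]
  exact (𝓕 φ).integrable

theorem fourierInv_fourier_schwartz (φ : SchwartzMap E ℂ) : 𝓕⁻ (𝓕 (φ : E → ℂ)) = φ :=
  φ.continuous.fourierInv_fourier_eq φ.integrable (integrable_fourier_schwartz φ)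

variable {μ : ℝ≥0 → Measure E} {ψ : E → ℂ}

namespace HasExponent

/-- Averaging over the translates by `-X_t` multiplies the Fourier transform by
`exp(-t conj ψ)`. -/
theorem integral_fourierInv_sub (h : HasExponent μ ψ) {m : E → ℂ} (hm : Integrable m) (t : ℝ≥0)
    (x : E) : ∫ y, 𝓕⁻ m (x - y) ∂(μ t)
      = 𝓕⁻ (fun ξ => Complex.exp (-(t : ℂ) * conj (ψ ((2 * Real.pi) • ξ))) * m ξ) x := by
  have := h.isProbabilityMeasure t
  simp_rw [Real.fourierInv_eq]
  rw [integral_integral_swap]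
  · congr 1
    ext ξ
    rw [← h.map_neg, ← h.charFun_eq, charFun_apply]
    have h1 : ∀ y, (Real.fourierChar (inner ℝ ξ (x - y)) : Circle) • m ξ
        = Complex.exp (inner ℝ y (-((2 * Real.pi) • ξ)) * Complex.I) *
          ((Real.fourierChar (inner ℝ ξ x) : Circle) • m ξ) := by
      intro y
      rw [inner_sub_right, sub_eq_neg_add, AddChar.map_add_eq_mul, mul_smul]
      rw [Circle.smul_def (Real.fourierChar (-inner ℝ ξ y)), Real.fourierChar_apply, smul_eq_mul,
        inner_neg_right, real_inner_smul_right, real_inner_comm]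
      congr 3
      push_cast
      ring
    simp_rw [h1]
    rw [integral_mul_const, Circle.smul_def, Circle.smul_def, smul_eq_mul, smul_eq_mul]
    ring
  · refine (hm.norm.comp_snd (μ t)).mono' ?_ (.of_forall fun p => ?_)
    · exact aestronglyMeasurable_fourierChar_smul (by fun_prop)
        hm.aestronglyMeasurable.comp_snd
    · simp only [Function.uncurry]
      rw [norm_fourierInv_integrand]

theorem re_conj_nonneg (h : HasExponent μ ψ) (ξ : E) : 0 ≤ (conj (ψ ξ)).re := by
  rw [Complex.conj_re]
  exact h.re_nonneg ξ

/-- Negative times are replaced by `0`, which makes the multipliers a continuous family bounded by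
`1` on all of `ℝ`. -/
theorem continuous_exp_mul (h : HasExponent μ ψ) :
    Continuous fun p : ℝ × E =>
      Complex.exp (-((max p.1 0 : ℝ) : ℂ) * conj (ψ ((2 * Real.pi) • p.2))) := by
  have := h.continuous
  fun_prop

theorem norm_exp_mul_le (h : HasExponent μ ψ) (s : ℝ) (ξ : E) (z : ℂ) :
    ‖Complex.exp (-((max s 0 : ℝ) : ℂ) * conj (ψ ((2 * Real.pi) • ξ))) * z‖ ≤ ‖z‖ := by
  rw [norm_mul]
  exact mul_le_of_le_one_left (norm_nonneg _)
    (norm_exp_neg_mul_le_one (h.re_conj_nonneg _) (le_max_right _ _))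

theorem continuous_fourierInv_exp_mul (h : HasExponent μ ψ) {m : E → ℂ} (hm : Integrable m) :
    Continuous fun p : ℝ × E =>
      𝓕⁻ (fun ξ => Complex.exp (-((max p.1 0 : ℝ) : ℂ) * conj (ψ ((2 * Real.pi) • ξ))) * m ξ)
        p.2 := by
  simp only [Real.fourierInv_eq]
  have hc := h.continuous
  refine continuous_of_dominated (bound := fun ξ => ‖m ξ‖) (fun p => ?_)
    (fun p => .of_forall fun ξ => ?_) hm.norm (.of_forall fun ξ => ?_)
  · exact aestronglyMeasurable_fourierChar_smul (by fun_prop)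
        (AEStronglyMeasurable.mul (Continuous.aestronglyMeasurable (by fun_prop))
        hm.aestronglyMeasurable)
  · rw [norm_fourierInv_integrand (fun ξ => _ * m ξ)]
    exact h.norm_exp_mul_le _ _ _
  · have h1 : Continuous fun p : ℝ × E => Real.fourierChar (inner ℝ ξ p.2) :=
      continuous_fourierChar_comp (by fun_prop)
    exact h1.smul (by fun_prop)

/-- Duhamel's formula for the adjoint semigroup, on the Fourier side. -/
theorem fourierInv_exp_mul_sub (h : HasExponent μ ψ) {m : E → ℂ} (hm : Integrable m)
    (hψm : Integrable fun ξ => -conj (ψ ((2 * Real.pi) • ξ)) * m ξ) (t : ℝ≥0) (x : E) :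
    𝓕⁻ (fun ξ => Complex.exp (-(t : ℂ) * conj (ψ ((2 * Real.pi) • ξ))) * m ξ) x - 𝓕⁻ m x
      = ∫ s in Set.Ioc (0 : ℝ) t, 𝓕⁻ (fun ξ =>
          Complex.exp (-((max s 0 : ℝ) : ℂ) * conj (ψ ((2 * Real.pi) • ξ)))
            * (-conj (ψ ((2 * Real.pi) • ξ)) * m ξ)) x := by
  have hc := h.continuous
  have hch : AEStronglyMeasurable (fun ξ : E => Real.fourierChar (inner ℝ ξ x)) :=
    Continuous.aestronglyMeasurable (continuous_fourierChar_comp (by fun_prop))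
  simp_rw [Real.fourierInv_eq]
  have hint : Integrable (fun ξ => Complex.exp (-(t : ℂ) * conj (ψ ((2 * Real.pi) • ξ))) * m ξ) := by
    refine hm.norm.mono' (AEStronglyMeasurable.mul
      (Continuous.aestronglyMeasurable (by fun_prop)) hm.aestronglyMeasurable)
      (.of_forall fun ξ => ?_)
    have := h.norm_exp_mul_le t ξ (m ξ)
    rwa [max_eq_left t.coe_nonneg] at this
  have hL : ∀ {u : E → ℂ}, Integrable u →
      Integrable (fun ξ => Real.fourierChar (inner ℝ ξ x) • u ξ) := fun {u} hu =>
    hu.norm.mono' (hch.smul hu.aestronglyMeasurable)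
      (.of_forall fun ξ => (norm_fourierInv_integrand u x ξ).le)
  rw [integral_integral_swap, ← integral_sub (hL hint) (hL hm)]
  · congr 1
    ext ξ
    rw [← intervalIntegral.integral_of_le t.coe_nonneg]
    have h1 := intervalIntegral_neg_mul_exp (conj (ψ ((2 * Real.pi) • ξ))) t
    have h2 : ∫ s in (0 : ℝ)..t, Real.fourierChar (inner ℝ ξ x) •
        (Complex.exp (-((max s 0 : ℝ) : ℂ) * conj (ψ ((2 * Real.pi) • ξ)))
            * (-conj (ψ ((2 * Real.pi) • ξ)) * m ξ))
        = ∫ s in (0 : ℝ)..t, (-conj (ψ ((2 * Real.pi) • ξ)) *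
          Complex.exp (-(s : ℂ) * conj (ψ ((2 * Real.pi) • ξ)))) *
            (Real.fourierChar (inner ℝ ξ x) • m ξ) := by
      refine intervalIntegral.integral_congr fun s hs => ?_
      rw [Set.uIcc_of_le t.coe_nonneg] at hs
      simp only [max_eq_left hs.1, Circle.smul_def, smul_eq_mul]
      ring
    rw [h2, intervalIntegral.integral_mul_const, h1]
    simp only [Circle.smul_def, smul_eq_mul]
    ring
  · have hdom : Integrable (fun p : ℝ × E => ‖-conj (ψ ((2 * Real.pi) • p.2)) * m p.2‖)
        ((volume.restrict (Set.Ioc (0 : ℝ) t)).prod volume) := hψm.norm.comp_snd _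
    refine hdom.mono' ?_ (.of_forall fun p => ?_)
    · exact aestronglyMeasurable_fourierChar_smul (by fun_prop)
        (AEStronglyMeasurable.mul h.continuous_exp_mul.aestronglyMeasurable
          hψm.aestronglyMeasurable.comp_snd)
    · simp only [Function.uncurry]
      rw [norm_fourierInv_integrand (fun ξ =>
        Complex.exp (-((max p.1 0 : ℝ) : ℂ) * conj (ψ ((2 * Real.pi) • ξ)))
            * (-conj (ψ ((2 * Real.pi) • ξ)) * m ξ))]
      exact h.norm_exp_mul_le _ _ _

theorem integrable_mul_fourier (h : HasExponent μ ψ) (φ : SchwartzMap E ℂ) :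
    Integrable fun ξ => -conj (ψ ((2 * Real.pi) • ξ)) * 𝓕 (φ : E → ℂ) ξ := by
  obtain ⟨C, hC0, hC⟩ := h.exists_norm_le
  have hc := h.continuous
  rw [← SchwartzMap.fourier_coe]
  have h0 := (𝓕 φ).integrable_pow_mul volume 0
  have h2 := (𝓕 φ).integrable_pow_mul volume 2
  refine ((h0.const_mul C).add (h2.const_mul (C * (2 * Real.pi) ^ 2))).mono'
    (AEStronglyMeasurable.mul (Continuous.aestronglyMeasurable (by fun_prop))
      (𝓕 φ).continuous.aestronglyMeasurable) (.of_forall fun ξ => ?_)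
  rw [norm_mul, norm_neg, RCLike.norm_conj]
  have h3 := hC ((2 * Real.pi) • ξ)
  rw [norm_smul, Real.norm_of_nonneg (by positivity), mul_pow] at h3
  calc _ ≤ C * (1 + (2 * Real.pi) ^ 2 * ‖ξ‖ ^ 2) * ‖(𝓕 φ) ξ‖ := by gcongr
    _ = _ := by simp; ring

theorem integral_schwartz_sub (h : HasExponent μ ψ) (φ : SchwartzMap E ℂ) (t : ℝ≥0) (x : E) :
    ∫ y, φ (x - y) ∂(μ t) = 𝓕⁻ (fun ξ =>
      Complex.exp (-(t : ℂ) * conj (ψ ((2 * Real.pi) • ξ))) * 𝓕 (φ : E → ℂ) ξ) x := by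
  rw [← h.integral_fourierInv_sub (integrable_fourier_schwartz φ), fourierInv_fourier_schwartz]

theorem continuous_adjointOp (h : HasExponent μ ψ) (φ : SchwartzMap E ℂ) :
    Continuous (adjointOp ψ φ) := by
  have h1 := h.continuous_fourierInv_exp_mul (h.integrable_mul_fourier φ)
  have h2 := h1.comp (Continuous.prodMk_right (0 : ℝ))
  simpa [Function.comp_def, adjointOp] using h2

theorem continuous_integral_adjointOp (h : HasExponent μ ψ) (φ : SchwartzMap E ℂ) :
    Continuous fun p : ℝ × E => ∫ y, adjointOp ψ φ (p.2 - y) ∂(μ p.1.toNNReal) := by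
  have h1 := h.continuous_fourierInv_exp_mul (h.integrable_mul_fourier φ)
  refine h1.congr fun p => ?_
  unfold adjointOp
  rw [h.integral_fourierInv_sub (h.integrable_mul_fourier φ), Real.coe_toNNReal']

/-- Duhamel's formula `P_t φ - φ = ∫₀ᵗ P_s L φ ds` for the adjoint semigroup. -/
theorem integral_schwartz_sub_sub (h : HasExponent μ ψ) (φ : SchwartzMap E ℂ) (t : ℝ≥0) (x : E) :
    ∫ y, φ (x - y) ∂(μ t) - φ x
      = ∫ s in Set.Ioc (0 : ℝ) t, ∫ y, adjointOp ψ φ (x - y) ∂(μ s.toNNReal) := by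
  unfold adjointOp
  simp_rw [h.integral_fourierInv_sub (h.integrable_mul_fourier φ), Real.coe_toNNReal']
  rw [h.integral_schwartz_sub, ← h.fourierInv_exp_mul_sub (integrable_fourier_schwartz φ)
    (h.integrable_mul_fourier φ), fourierInv_fourier_schwartz]

/-- The difference quotients of the adjoint semigroup converge pointwise to its generator. -/
theorem tendsto_adjointOp (h : HasExponent μ ψ) (φ : SchwartzMap E ℂ) (x : E) :
    Tendsto (fun k : ℕ => ((k : ℂ) + 1) *
      (∫ y, φ (x - y) ∂(μ (1 / ((k : ℝ) + 1)).toNNReal) - φ x)) atTop (𝓝 (adjointOp ψ φ x)) := by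
  have hc := h.continuous
  have hF : Continuous (𝓕 (φ : E → ℂ)) := by
    rw [← SchwartzMap.fourier_coe]
    exact (𝓕 φ).continuous
  have hlim := tendsto_fourierInv_of_dominated (x := x)
    (m := fun (k : ℕ) ξ => ((k : ℂ) + 1) *
      (Complex.exp (-((1 / ((k : ℝ) + 1) : ℝ) : ℂ) * conj (ψ ((2 * Real.pi) • ξ))) - 1)
        * 𝓕 (φ : E → ℂ) ξ) (fun k => Continuous.aestronglyMeasurable (by fun_prop))
    (h.integrable_mul_fourier φ).norm (fun k ξ => ?_)
    (fun ξ => (tendsto_exp_neg_mul_sub_one_div _).mul_const _)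
  · refine hlim.congr fun k => ?_
    rw [h.integral_schwartz_sub, Real.coe_toNNReal _ (by positivity)]
    rw [← congrFun (fourierInv_fourier_schwartz φ) x]
    simp_rw [Real.fourierInv_eq]
    rw [← integral_sub, ← integral_const_mul]
    · congr 1
      ext ξ
      simp only [Circle.smul_def, smul_eq_mul]
      ring
    · have hi : Integrable (fun ξ => Complex.exp (-((1 / ((k : ℝ) + 1) : ℝ) : ℂ)
          * conj (ψ ((2 * Real.pi) • ξ))) * 𝓕 (φ : E → ℂ) ξ) := by
        refine (integrable_fourier_schwartz φ).norm.mono'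
          (Continuous.aestronglyMeasurable (by fun_prop)) (.of_forall fun ξ => ?_)
        have := h.norm_exp_mul_le (1 / ((k : ℝ) + 1)) ξ (𝓕 (φ : E → ℂ) ξ)
        rwa [max_eq_left (by positivity)] at this
      refine hi.norm.mono' (Continuous.aestronglyMeasurable ?_)
        (.of_forall fun ξ => (norm_fourierInv_integrand (fun ξ => _ * 𝓕 (φ : E → ℂ) ξ) x ξ).le)
      exact (continuous_fourierChar_comp (by fun_prop)).smul (by fun_prop)
    · refine (integrable_fourier_schwartz φ).norm.mono' (Continuous.aestronglyMeasurable ?_)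
        (.of_forall fun ξ => (norm_fourierInv_integrand _ x ξ).le)
      exact (continuous_fourierChar_comp (by fun_prop)).smul hF
  · rw [norm_mul, norm_mul, norm_mul]
    gcongr
    have hk : (0 : ℝ) < (k : ℝ) + 1 := by positivity
    have h4 : ‖(k : ℂ) + 1‖ = (k : ℝ) + 1 := by
      rw [← Nat.cast_add_one, Complex.norm_natCast, Nat.cast_add_one]
    have h5 := norm_exp_neg_mul_sub_one_le (h.re_conj_nonneg ((2 * Real.pi) • ξ))
      (t := 1 / ((k : ℝ) + 1)) (by positivity)
    rw [h4, norm_neg]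
    calc _ ≤ ((k : ℝ) + 1) * (1 / ((k : ℝ) + 1) * ‖conj (ψ ((2 * Real.pi) • ξ))‖) := by gcongr
      _ = _ := by field_simp

end HasExponent

end LevyLiouville

/-! ### Integrability of the adjoint generator on test functions -/

namespace LevyLiouville

variable {E : Type*} [NormedAddCommGroup E] [InnerProductSpace ℝ E] [FiniteDimensional ℝ E]
  [MeasurableSpace E] [BorelSpace E]

/-- Second-order remainder of the translate `φ (x - y)`, where the linear term is evaluated at
the truncation of `y`. -/
noncomputable def translateRemainder (φ : E → ℂ) (x y : E) : ℂ :=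
  φ (x - y) - φ x + fderiv ℝ φ x (sinTrunc y)

theorem continuous_translateRemainder {φ : E → ℂ} (hφ : ContDiff ℝ (⊤ : ℕ∞) φ) :
    Continuous fun p : E × E => translateRemainder φ p.1 p.2 := by
  have h1 := hφ.continuous
  have h2 : Continuous (fderiv ℝ φ) := hφ.continuous_fderiv (by simp)
  have h3 := continuous_sinTrunc (E := E)
  unfold translateRemainder
  fun_prop

/-- The mean value inequality for the Lipschitz derivative bounds the Taylor remainder; replacing
`y` by its truncation costs another multiple of `‖y‖²`. -/
theorem exists_norm_translateRemainder_le {φ : E → ℂ} (hφ : ContDiff ℝ (⊤ : ℕ∞) φ)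
    (hc : HasCompactSupport φ) :
    ∃ K, 0 ≤ K ∧ ∀ x y, ‖translateRemainder φ x y‖ ≤ K * ‖y‖ ^ 2 := by
  have hd : ContDiff ℝ (⊤ : ℕ∞) (fderiv ℝ φ) := hφ.fderiv_right (by simp)
  obtain ⟨L, hL⟩ := ContDiff.lipschitzWith_of_hasCompactSupport (hc.fderiv ℝ) hd (by simp)
  obtain ⟨M, hM⟩ := (hc.fderiv ℝ).exists_bound_of_continuous hd.continuous
  have hM0 : 0 ≤ M := (norm_nonneg _).trans (hM 0)
  refine ⟨L + 2 * M, by positivity, fun x y => ?_⟩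
  have h1 : ‖φ (x - y) - φ x - fderiv ℝ φ x (x - y - x)‖ ≤ (L * ‖y‖) * ‖x - y - x‖ := by
    refine (convex_closedBall x ‖y‖).norm_image_sub_le_of_norm_hasFDerivWithin_le'
      (f' := fderiv ℝ φ) (fun z _ => ?_) (fun z hz => ?_) ?_ ?_
    · exact ((hφ.differentiable (by simp)) z).hasFDerivAt.hasFDerivWithinAt
    · refine (hL.norm_sub_le z x).trans ?_
      gcongr
      exact mem_closedBall_iff_norm.1 hz
    · exact Metric.mem_closedBall_self (norm_nonneg _)
    · simp
  have h2 : translateRemainder φ x y = (φ (x - y) - φ x - fderiv ℝ φ x (x - y - x))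
      + fderiv ℝ φ x (sinTrunc y - y) := by
    rw [sub_sub_cancel_left, map_neg, map_sub, translateRemainder]
    ring
  rw [h2]
  have h3 : ‖fderiv ℝ φ x (sinTrunc y - y)‖ ≤ M * (2 * ‖y‖ ^ 2) :=
    (ContinuousLinearMap.le_opNorm _ _).trans
      (mul_le_mul (hM x) (norm_sinTrunc_sub_le y) (norm_nonneg _) hM0)
  refine (norm_add_le_of_le h1 h3).trans_eq ?_
  rw [sub_sub_cancel_left, norm_neg]
  ring

/-- The `L¹` norm of the second-order remainder is controlled by the truncated square of the
translation. -/
theorem exists_lintegral_translateRemainder_le {φ : E → ℂ} (hφ : ContDiff ℝ (⊤ : ℕ∞) φ)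
    (hc : HasCompactSupport φ) :
    ∃ K, 0 ≤ K ∧ ∀ y, ∫⁻ x, ‖translateRemainder φ x y‖ₑ ≤ ENNReal.ofReal (K * min 1 (‖y‖ ^ 2)) := by
  obtain ⟨K, hK0, hK⟩ := exists_norm_translateRemainder_le hφ hc
  have hφi : Integrable φ := hφ.continuous.integrable_of_hasCompactSupport hc
  have hdi : Integrable (fderiv ℝ φ) :=
    (hφ.continuous_fderiv (by simp)).integrable_of_hasCompactSupport (hc.fderiv ℝ)
  set T : Set E := Metric.cthickening 1 (tsupport φ) with hT
  have hTc : IsCompact T := hc.isCompact.cthickening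
  set A : ℝ := 2 * ∫ x, ‖φ x‖ with hA
  set B : ℝ := ∫ x, ‖fderiv ℝ φ x‖ with hB
  have hA0 : 0 ≤ A := by positivity
  have hB0 : 0 ≤ B := by positivity
  refine ⟨K * volume.real T + (A + B * Module.finrank ℝ E), by positivity, fun y => ?_⟩
  rcases le_or_gt ‖y‖ 1 with hy | hy
  · -- the remainder of a short translation vanishes away from the support of `φ`
    have hbound : ∀ x, ‖translateRemainder φ x y‖ₑ
        ≤ T.indicator (fun _ => ENNReal.ofReal (K * ‖y‖ ^ 2)) x := by
      intro x
      by_cases hx : x ∈ T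
      · rw [Set.indicator_of_mem hx, ← ofReal_norm]
        exact ENNReal.ofReal_le_ofReal (hK x y)
      · have hx1 : x ∉ tsupport φ := fun h => hx (Metric.self_subset_cthickening _ h)
        have hx2 : x - y ∉ tsupport φ := fun h =>
          hx (Metric.mem_cthickening_of_dist_le x (x - y) 1 _ h (by simpa [dist_eq_norm] using hy))
        have h0 : translateRemainder φ x y = 0 := by
          rw [translateRemainder, image_eq_zero_of_notMem_tsupport hx1,
            image_eq_zero_of_notMem_tsupport hx2, fderiv_of_notMem_tsupport ℝ hx1]
          simp
        simp [h0]
    rw [min_eq_right (pow_le_one₀ (norm_nonneg _) hy)]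
    calc ∫⁻ x, ‖translateRemainder φ x y‖ₑ
        ≤ ENNReal.ofReal (K * ‖y‖ ^ 2) * volume T := by
          refine (lintegral_mono hbound).trans_eq ?_
          rw [lintegral_indicator hTc.isClosed.measurableSet, setLIntegral_const]
      _ = ENNReal.ofReal (K * volume.real T * ‖y‖ ^ 2) := by
          rw [← ofReal_measureReal hTc.measure_lt_top.ne, ← ENNReal.ofReal_mul (by positivity)]
          congr 1
          ring
      _ ≤ _ := by
          refine ENNReal.ofReal_le_ofReal ?_
          gcongr
          have : 0 ≤ B * Module.finrank ℝ E := by positivity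
          linarith
  · rw [min_eq_left (one_le_pow₀ hy.le), mul_one]
    have h1 : Integrable (fun x => φ (x - y)) := hφi.comp_sub_right y
    have h2 : Integrable (fun x => fderiv ℝ φ x (sinTrunc y)) := hdi.apply_continuousLinearMap _
    have hi : Integrable (fun x => translateRemainder φ x y) := (h1.sub hφi).add h2
    simp_rw [← ofReal_norm]
    rw [← ofReal_integral_eq_lintegral_ofReal hi.norm (.of_forall fun x => norm_nonneg _)]
    refine ENNReal.ofReal_le_ofReal ?_
    have h3 : ∫ x, ‖translateRemainder φ x y‖
        ≤ ∫ x, (‖φ (x - y)‖ + ‖φ x‖ + ‖fderiv ℝ φ x‖ * Module.finrank ℝ E) := by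
      refine integral_mono hi.norm ((h1.norm.add hφi.norm).add (hdi.norm.mul_const _)) fun x => ?_
      refine norm_add_le_of_le (norm_sub_le _ _) ?_
      exact (ContinuousLinearMap.le_opNorm _ _).trans (by gcongr; exact norm_sinTrunc_le y)
    have h12 : Integrable (fun x => ‖φ (x - y)‖ + ‖φ x‖) := h1.norm.add hφi.norm
    rw [integral_add h12 (hdi.norm.mul_const _), integral_add h1.norm hφi.norm,
      integral_mul_const, integral_sub_right_eq_self (fun x => ‖φ x‖) y] at h3
    have : 0 ≤ K * volume.real T := by positivity
    linarith

variable {μ : ℝ≥0 → Measure E} {ψ : E → ℂ}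

namespace HasExponent

/-- The adjoint semigroup is Lipschitz in time, in `L¹`, at a test function. -/
theorem exists_lintegral_integral_sub_sub_le (h : HasExponent μ ψ) {φ : E → ℂ}
    (hφ : ContDiff ℝ (⊤ : ℕ∞) φ) (hc : HasCompactSupport φ) :
    ∃ C, 0 ≤ C ∧ ∀ t : ℝ≥0, ∫⁻ x, ‖∫ y, φ (x - y) ∂(μ t) - φ x‖ₑ ≤ ENNReal.ofReal (C * t) := by
  obtain ⟨K, hK0, hK⟩ := exists_lintegral_translateRemainder_le hφ hc
  obtain ⟨C₁, hC₁, h₁⟩ := h.integral_min_one_norm_sq_le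
  obtain ⟨C₂, hC₂, h₂⟩ := h.norm_integral_sinTrunc_le
  have hdc : Continuous (fderiv ℝ φ) := hφ.continuous_fderiv (by simp)
  have hdi : Integrable (fderiv ℝ φ) := hdc.integrable_of_hasCompactSupport (hc.fderiv ℝ)
  obtain ⟨M, hM⟩ := hc.exists_bound_of_continuous hφ.continuous
  set B : ℝ := ∫ x, ‖fderiv ℝ φ x‖ with hB
  have hB0 : 0 ≤ B := by positivity
  refine ⟨K * C₁ + B * C₂, by positivity, fun t => ?_⟩
  have := h.isProbabilityMeasure t
  have hS := h.integrable_sinTrunc t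
  have hRc := continuous_translateRemainder hφ
  have hsplit : ∀ x, ∫ y, φ (x - y) ∂(μ t) - φ x
      = ∫ y, translateRemainder φ x y ∂(μ t) - fderiv ℝ φ x (∫ y, sinTrunc y ∂(μ t)) := by
    intro x
    have hi1 : Integrable (fun y => φ (x - y)) (μ t) := by
      have := hφ.continuous
      exact .of_bound (Continuous.aestronglyMeasurable (by fun_prop)) M (.of_forall fun y => hM _)
    have hi2 : Integrable (fun y => φ (x - y) - φ x) (μ t) := hi1.sub (integrable_const _)
    have hi3 : Integrable (fun y => fderiv ℝ φ x (sinTrunc y)) (μ t) :=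
      (fderiv ℝ φ x).integrable_comp hS
    unfold translateRemainder
    rw [integral_add hi2 hi3, integral_sub hi1 (integrable_const _),
      (fderiv ℝ φ x).integral_comp_comm hS]
    simp
  calc ∫⁻ x, ‖∫ y, φ (x - y) ∂(μ t) - φ x‖ₑ
      ≤ ∫⁻ x, (∫⁻ y, ‖translateRemainder φ x y‖ₑ ∂(μ t)
          + ‖fderiv ℝ φ x‖ₑ * ‖∫ y, sinTrunc y ∂(μ t)‖ₑ) := by
        refine lintegral_mono fun x => ?_
        rw [hsplit]
        refine enorm_sub_le.trans (add_le_add (enorm_integral_le_lintegral_enorm _) ?_)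
        exact ContinuousLinearMap.le_opENorm _ _
    _ = (∫⁻ y, (∫⁻ x, ‖translateRemainder φ x y‖ₑ) ∂(μ t))
          + (∫⁻ x, ‖fderiv ℝ φ x‖ₑ) * ‖∫ y, sinTrunc y ∂(μ t)‖ₑ := by
        rw [lintegral_add_right _ (by fun_prop), lintegral_mul_const _ (by fun_prop),
          lintegral_lintegral_swap]
        exact hRc.enorm.aemeasurable
    _ ≤ ENNReal.ofReal (K * (C₁ * t)) + ENNReal.ofReal B * ENNReal.ofReal (C₂ * t) := by
        gcongr ?_ + ?_ * ?_
        · refine (lintegral_mono hK).trans ?_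
          rw [← ofReal_integral_eq_lintegral_ofReal, integral_const_mul]
          · exact ENNReal.ofReal_le_ofReal (by gcongr; exact h₁ t)
          · refine Integrable.const_mul (.of_bound (Continuous.aestronglyMeasurable
              (by fun_prop)) 1 (.of_forall fun y => ?_)) _
            rw [Real.norm_of_nonneg (le_min zero_le_one (sq_nonneg _))]
            exact min_le_left _ _
          · exact .of_forall fun y => mul_nonneg hK0 (le_min zero_le_one (sq_nonneg _))
        · simp_rw [← ofReal_norm]
          rw [← ofReal_integral_eq_lintegral_ofReal hdi.norm (.of_forall fun x => norm_nonneg _)]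
        · rw [← ofReal_norm]
          exact ENNReal.ofReal_le_ofReal (h₂ t)
    _ = _ := by
        rw [← ENNReal.ofReal_mul hB0, ← ENNReal.ofReal_add (by positivity) (by positivity)]
        congr 1
        ring

/-- The adjoint generator maps test functions to integrable functions, by Fatou's lemma applied
to the difference quotients of the semigroup. -/
theorem integrable_adjointOp (h : HasExponent μ ψ) {φ : E → ℂ}
    (hφ : ContDiff ℝ (⊤ : ℕ∞) φ) (hc : HasCompactSupport φ) : Integrable (adjointOp ψ φ) := by
  obtain ⟨C, hC0, hC⟩ := h.exists_lintegral_integral_sub_sub_le hφ hc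
  have hlim : ∀ x, Tendsto (fun k : ℕ => ((k : ℂ) + 1) *
      (∫ y, φ (x - y) ∂(μ (1 / ((k : ℝ) + 1)).toNNReal) - φ x)) atTop (𝓝 (adjointOp ψ φ x)) :=
    h.tendsto_adjointOp (hc.toSchwartzMap hφ)
  have hcont : Continuous (adjointOp ψ φ) := h.continuous_adjointOp (hc.toSchwartzMap hφ)
  have hPc : ∀ t, StronglyMeasurable fun x => ∫ y, φ (x - y) ∂(μ t) := by
    intro t
    have := h.isProbabilityMeasure t
    have hφc := hφ.continuous
    exact StronglyMeasurable.integral_prod_right' (f := fun p : E × E => φ (p.1 - p.2))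
      (Continuous.stronglyMeasurable (by fun_prop))
  refine ⟨hcont.aestronglyMeasurable, lt_of_le_of_lt ?_ (ENNReal.ofReal_lt_top (r := C))⟩
  calc ∫⁻ x, ‖adjointOp ψ φ x‖ₑ
      = ∫⁻ x, liminf (fun k : ℕ => ‖((k : ℂ) + 1) *
        (∫ y, φ (x - y) ∂(μ (1 / ((k : ℝ) + 1)).toNNReal) - φ x)‖ₑ) atTop :=
        lintegral_congr fun x => ((hlim x).enorm.liminf_eq).symm
    _ ≤ liminf (fun k : ℕ => ∫⁻ x, ‖((k : ℂ) + 1) *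
        (∫ y, φ (x - y) ∂(μ (1 / ((k : ℝ) + 1)).toNNReal) - φ x)‖ₑ) atTop := by
        refine lintegral_liminf_le' fun k => ?_
        exact ((((hPc _).sub hφ.continuous.stronglyMeasurable).const_mul
          ((k : ℂ) + 1)).aestronglyMeasurable).enorm
    _ ≤ ENNReal.ofReal C := by
        refine liminf_le_of_le (by isBoundedDefault) fun b hb => ?_
        obtain ⟨k, hk⟩ := hb.exists
        refine hk.trans ?_
        have hk1 : (0 : ℝ) < (k : ℝ) + 1 := by positivity
        have h4 : ‖(k : ℂ) + 1‖ₑ = ENNReal.ofReal ((k : ℝ) + 1) := by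
          rw [← ofReal_norm, ← Nat.cast_add_one, Complex.norm_natCast, Nat.cast_add_one]
        simp_rw [enorm_mul, h4]
        rw [lintegral_const_mul' _ _ ENNReal.ofReal_ne_top]
        calc _ ≤ ENNReal.ofReal ((k : ℝ) + 1)
              * ENNReal.ofReal (C * (1 / ((k : ℝ) + 1)).toNNReal) := by gcongr; exact hC _
          _ = _ := by
            rw [← ENNReal.ofReal_mul hk1.le, Real.coe_toNNReal _ (by positivity)]
            congr 1
            field_simp

end HasExponent

end LevyLiouville

/-! ### Bounded solutions are harmonic for the process -/

namespace LevyLiouville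

variable {E : Type*} [NormedAddCommGroup E] [InnerProductSpace ℝ E] [FiniteDimensional ℝ E]
  [MeasurableSpace E] [BorelSpace E]

theorem integrable_comp_sub_prod {g : E → ℂ} (hg : Integrable g) (hgc : Continuous g)
    (ν : Measure E) [IsProbabilityMeasure ν] :
    Integrable (fun p : E × E => g (p.1 - p.2)) (volume.prod ν) := by
  rw [integrable_prod_iff' (Continuous.aestronglyMeasurable (by fun_prop))]
  refine ⟨.of_forall fun y => hg.comp_sub_right y, ?_⟩
  simp_rw [integral_sub_right_eq_self (fun x => ‖g x‖)]
  exact integrable_const _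

theorem integral_norm_integral_comp_sub_le {g : E → ℂ} (hg : Integrable g) (hgc : Continuous g)
    (ν : Measure E) [IsProbabilityMeasure ν] :
    ∫ x, ‖∫ y, g (x - y) ∂ν‖ ≤ ∫ x, ‖g x‖ := by
  have hi := integrable_comp_sub_prod hg hgc ν
  calc ∫ x, ‖∫ y, g (x - y) ∂ν‖ ≤ ∫ x, ∫ y, ‖g (x - y)‖ ∂ν :=
        integral_mono hi.integral_prod_left.norm hi.norm.integral_prod_left
          fun x => norm_integral_le_integral_norm _
    _ = ∫ y, (∫ x, ‖g (x - y)‖) ∂ν := integral_integral_swap hi.norm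
    _ = ∫ x, ‖g x‖ := by
        simp_rw [integral_sub_right_eq_self (fun x => ‖g x‖)]
        simp

theorem integral_mul_integral_comp_sub {f g : E → ℂ} (hf : StronglyMeasurable f) {B : ℝ}
    (hB : ∀ x, ‖f x‖ ≤ B) (hg : Integrable g) (hgc : Continuous g) (ν : Measure E)
    [IsProbabilityMeasure ν] :
    ∫ x, f x * ∫ y, g (x - y) ∂ν = ∫ y, (∫ x, f x * g (x - y)) ∂ν := by
  rw [← integral_integral_swap]
  · simp_rw [integral_const_mul]
  · exact (integrable_comp_sub_prod hg hgc ν).bdd_mul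
      (hf.comp_measurable measurable_fst).aestronglyMeasurable (.of_forall fun p => hB p.1)

variable {μ : ℝ≥0 → Measure E} {ψ : E → ℂ} {f : E → ℂ}

/-- The pairings of a bounded solution with test functions are invariant under the adjoint
semigroup. By Duhamel's formula the pairing changes by the time integral of its pairings with
`P_s L φ`, and `P_s L φ` is a superposition of translates `L φ (· - y) = L (φ (· - y))`, with each
of which the solution has pairing zero. -/
theorem HasExponent.integral_mul_integral_eq (h : HasExponent μ ψ) (hf : StronglyMeasurable f)
    {B : ℝ} (hB : ∀ x, ‖f x‖ ≤ B)
    (hsol : ∀ φ : E → ℂ, ContDiff ℝ (⊤ : ℕ∞) φ → HasCompactSupport φ →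
      ∫ x, f x * adjointOp ψ φ x = 0)
    {φ : E → ℂ} (hφ : ContDiff ℝ (⊤ : ℕ∞) φ) (hc : HasCompactSupport φ) (t : ℝ≥0) :
    ∫ x, f x * ∫ y, φ (x - y) ∂(μ t) = ∫ x, f x * φ x := by
  have hprob := h.isProbabilityMeasure
  have hLi := h.integrable_adjointOp hφ hc
  have hLc : Continuous (adjointOp ψ φ) := h.continuous_adjointOp (hc.toSchwartzMap hφ)
  have hφi : Integrable φ := hφ.continuous.integrable_of_hasCompactSupport hc
  have hshift : ∀ y, ∫ x, f x * adjointOp ψ φ (x - y) = 0 := by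
    intro y
    simp_rw [← adjointOp_comp_sub_right]
    exact hsol _ (hφ.comp (contDiff_id.sub contDiff_const))
      (hc.comp_homeomorph (Homeomorph.subRight y))
  have hzero : ∀ s, ∫ x, f x * ∫ y, adjointOp ψ φ (x - y) ∂(μ s) = 0 := by
    intro s
    rw [integral_mul_integral_comp_sub hf hB hLi hLc]
    simp [hshift]
  have hduh : ∀ x, ∫ y, φ (x - y) ∂(μ t) - φ x
      = ∫ s in Set.Ioc (0 : ℝ) t, ∫ y, adjointOp ψ φ (x - y) ∂(μ s.toNNReal) :=
    h.integral_schwartz_sub_sub (hc.toSchwartzMap hφ) t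
  have hHc : Continuous fun p : ℝ × E => ∫ y, adjointOp ψ φ (p.2 - y) ∂(μ p.1.toNNReal) :=
    h.continuous_integral_adjointOp (hc.toSchwartzMap hφ)
  have hHc' : Continuous fun p : E × ℝ => ∫ y, adjointOp ψ φ (p.1 - y) ∂(μ p.2.toNNReal) :=
    hHc.comp continuous_swap
  have hHi : Integrable (fun p : E × ℝ => ∫ y, adjointOp ψ φ (p.1 - y) ∂(μ p.2.toNNReal))
      (volume.prod (volume.restrict (Set.Ioc (0 : ℝ) t))) := by
    rw [integrable_prod_iff' hHc'.aestronglyMeasurable]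
    refine ⟨.of_forall fun s =>
      (integrable_comp_sub_prod hLi hLc (μ s.toNNReal)).integral_prod_left, ?_⟩
    refine Integrable.mono' (g := fun _ => ∫ x, ‖adjointOp ψ φ x‖) (integrable_const _) ?_
      (.of_forall fun s => ?_)
    · exact (StronglyMeasurable.integral_prod_right'
        (f := fun p : ℝ × E => ‖∫ y, adjointOp ψ φ (p.2 - y) ∂(μ p.1.toNNReal)‖)
        hHc.norm.stronglyMeasurable).aestronglyMeasurable
    · rw [Real.norm_of_nonneg (integral_nonneg fun x => norm_nonneg _)]
      exact integral_norm_integral_comp_sub_le hLi hLc (μ s.toNNReal)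
  have hfb : ∀ {u : E → ℂ}, Integrable u → Integrable fun x => f x * u x := fun hu =>
    hu.bdd_mul hf.aestronglyMeasurable (.of_forall hB)
  rw [← sub_eq_zero, ← integral_sub
    (hfb (integrable_comp_sub_prod hφi hφ.continuous (μ t)).integral_prod_left) (hfb hφi)]
  simp_rw [← mul_sub, hduh, ← integral_const_mul]
  rw [integral_integral_swap]
  · simp_rw [integral_const_mul, hzero]
    simp
  · simp_rw [integral_const_mul]
    exact hHi.bdd_mul (hf.comp_measurable measurable_fst).aestronglyMeasurable
      (.of_forall fun p => hB p.1)

/-- The mollification of `f` by the reflection of `φ`: its value at `x` is the pairing of `f`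
with the translate of `φ` by `x`. -/
noncomputable def translatePairing (f φ : E → ℂ) (x : E) : ℂ := ∫ z, f z * φ (z - x)

theorem continuous_translatePairing (hf : StronglyMeasurable f) {B : ℝ} (hB : ∀ x, ‖f x‖ ≤ B)
    {φ : E → ℂ} (hφ : Continuous φ) (hc : HasCompactSupport φ) :
    Continuous (translatePairing f φ) := by
  have hloc : LocallyIntegrable f := fun x =>
    ⟨Metric.ball x 1, Metric.ball_mem_nhds x one_pos, Measure.integrableOn_of_bounded
      measure_ball_lt_top.ne hf.aestronglyMeasurable (.of_forall hB)⟩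
  have hc' : HasCompactSupport fun w => φ (-w) := hc.comp_homeomorph (Homeomorph.neg E)
  have := hc'.continuous_convolution_right (ContinuousLinearMap.mul ℝ ℂ) hloc
    (hφ.comp continuous_neg)
  refine this.congr fun x => ?_
  simp [convolution, translatePairing]

theorem norm_translatePairing_le {B : ℝ} (hB : ∀ x, ‖f x‖ ≤ B) {φ : E → ℂ} (hφ : Integrable φ)
    (x : E) : ‖translatePairing f φ x‖ ≤ B * ∫ z, ‖φ z‖ := by
  refine (norm_integral_le_of_norm_le (g := fun z => B * ‖φ (z - x)‖)
    ((hφ.comp_sub_right x).norm.const_mul B) (.of_forall fun z => ?_)).trans_eq ?_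
  · rw [norm_mul]
    exact mul_le_mul_of_nonneg_right (hB z) (norm_nonneg _)
  · rw [integral_const_mul, integral_sub_right_eq_self (fun x => ‖φ x‖)]

/-- The group of translations which leave all mollifications of `f` invariant. -/
noncomputable def translateInvariance (f : E → ℂ) : AddSubgroup E where
  carrier := {h | ∀ φ : E → ℂ, ContDiff ℝ (⊤ : ℕ∞) φ → HasCompactSupport φ →
    ∀ x, translatePairing f φ (x + h) = translatePairing f φ x}
  zero_mem' := fun φ _ _ x => by rw [add_zero]
  add_mem' := fun {a b} ha hb φ hφ hc x => by rw [← add_assoc, hb φ hφ hc, ha φ hφ hc]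
  neg_mem' := fun {a} ha φ hφ hc x => by
    rw [← ha φ hφ hc (x + -a), neg_add_cancel_right]

theorem isClosed_translateInvariance (hf : StronglyMeasurable f) {B : ℝ} (hB : ∀ x, ‖f x‖ ≤ B) :
    IsClosed (translateInvariance f : Set E) := by
  have : (translateInvariance f : Set E) = ⋂ (φ : E → ℂ) (_ : ContDiff ℝ (⊤ : ℕ∞) φ)
      (_ : HasCompactSupport φ) (x : E),
      {h | translatePairing f φ (x + h) = translatePairing f φ x} := by
    ext h
    simp [translateInvariance]
  rw [this]
  refine isClosed_iInter fun φ => isClosed_iInter fun hφ => isClosed_iInter fun hc =>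
    isClosed_iInter fun x => ?_
  have := continuous_translatePairing hf hB hφ.continuous hc
  exact isClosed_eq (by fun_prop) continuous_const

theorem ae_translate_eq_of_mem_translateInvariance (hf : StronglyMeasurable f) {B : ℝ}
    (hB : ∀ x, ‖f x‖ ≤ B) {h : E} (hh : h ∈ translateInvariance f) :
    (fun x => f (x + h)) =ᵐ[volume] f := by
  have hloc : ∀ {u : E → ℂ}, StronglyMeasurable u → (∀ x, ‖u x‖ ≤ B) → LocallyIntegrable u :=
    fun hu hb x => ⟨Metric.ball x 1, Metric.ball_mem_nhds x one_pos,
      Measure.integrableOn_of_bounded measure_ball_lt_top.ne hu.aestronglyMeasurable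
        (.of_forall hb)⟩
  refine ae_eq_of_integral_contDiff_smul_eq
    (hloc (hf.comp_measurable (measurable_add_const h)) fun x => hB _) (hloc hf hB)
    fun g hg hgc => ?_
  have h1 := hh (fun x => (g x : ℂ)) (Complex.ofRealCLM.contDiff.comp hg)
    (hgc.comp_left (g := Complex.ofReal) Complex.ofReal_zero) 0
  simp only [translatePairing, zero_add, sub_zero] at h1
  rw [← integral_add_right_eq_self _ h] at h1
  simp only [add_sub_cancel_right] at h1
  simpa [Complex.real_smul, mul_comm] using h1

/-- Choquet–Deny for a bounded solution: the marginals of the process are carried by the group of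
translations under which the solution is invariant. -/
theorem HasExponent.ae_mem_translateInvariance (h : HasExponent μ ψ) (hf : StronglyMeasurable f)
    {B : ℝ} (hB : ∀ x, ‖f x‖ ≤ B)
    (hsol : ∀ φ : E → ℂ, ContDiff ℝ (⊤ : ℕ∞) φ → HasCompactSupport φ →
      ∫ x, f x * adjointOp ψ φ x = 0) (t : ℝ≥0) :
    ∀ᵐ y ∂(μ t), y ∈ translateInvariance f := by
  have := h.isProbabilityMeasure t
  -- invariance is a closed condition, so that it is enough to treat one `φ` and `x` at a time
  filter_upwards [Measure.support_mem_ae (μ := μ t)] with y hy φ hφ hc x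
  have hφi : Integrable φ := hφ.continuous.integrable_of_hasCompactSupport hc
  have hcont := continuous_translatePairing hf hB hφ.continuous hc
  have hharm : ∀ x, ∫ y, translatePairing f φ (x + y) ∂(μ t) = translatePairing f φ x := by
    intro x
    have h1 := h.integral_mul_integral_eq hf hB hsol
      (φ := fun z => φ (z - x)) (hφ.comp (contDiff_id.sub contDiff_const))
      (hc.comp_homeomorph (Homeomorph.subRight x)) t
    rw [integral_mul_integral_comp_sub hf hB (hφi.comp_sub_right x)
      (hφ.continuous.comp (continuous_id.sub continuous_const))] at h1
    simp only [translatePairing]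
    rw [← h1]
    simp_rw [sub_sub, add_comm x]
  have hae := ae_translate_eq_of_integral_translate_eq hcont (norm_translatePairing_le hB hφi)
    hharm x
  exact Measure.support_subset_of_isClosed
    (isClosed_eq (hcont.comp (continuous_const.add continuous_id)) continuous_const) hae hy

/-- Bounded solutions are periodic with respect to the annihilator of the zero set of the
exponent. A point outside the closed group of invariant translations would be separated from it by
a character which is trivial on that group, hence on the values of the process; such a character
is a zero of the exponent. -/
theorem HasExponent.mem_translateInvariance (h : HasExponent μ ψ) (hf : StronglyMeasurable f)
    {B : ℝ} (hB : ∀ x, ‖f x‖ ≤ B)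
    (hsol : ∀ φ : E → ℂ, ContDiff ℝ (⊤ : ℕ∞) φ → HasCompactSupport φ →
      ∫ x, f x * adjointOp ψ φ x = 0) {a : E}
    (ha : ∀ g, ψ g = 0 → Complex.exp (Complex.I * (inner ℝ a g : ℝ)) = 1) :
    a ∈ translateInvariance f := by
  by_contra hmem
  obtain ⟨ξ, hξ, hξa⟩ := AddSubgroup.exists_inner_intCast_of_isClosed
    (isClosed_translateInvariance hf hB) hmem
  have hψ : ψ ((2 * Real.pi) • ξ) = 0 := by
    refine h.eq_zero_of_charFun_eq_one fun t => ?_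
    have := h.isProbabilityMeasure t
    rw [charFun_apply]
    have h1 : ∀ᵐ y ∂(μ t), Complex.exp (inner ℝ y ((2 * Real.pi) • ξ) * Complex.I) = 1 := by
      filter_upwards [h.ae_mem_translateInvariance hf hB hsol t] with y hy
      obtain ⟨m, hm⟩ := hξ y hy
      rw [real_inner_smul_right, real_inner_comm, hm, Complex.exp_eq_one_iff]
      exact ⟨m, by push_cast; ring⟩
    rw [integral_congr_ae h1]
    simp
  obtain ⟨m, hm⟩ := Complex.exp_eq_one_iff.1 (ha _ hψ)
  refine hξa m ?_
  rw [real_inner_smul_right, real_inner_comm] at hm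
  have h2 : ((2 * Real.pi * Complex.I) : ℂ) ≠ 0 := Complex.two_pi_I_ne_zero
  have h3 : ((inner ℝ ξ a : ℝ) : ℂ) = m := by
    apply mul_right_cancel₀ h2
    rw [← hm]
    push_cast
    ring
  exact_mod_cast h3

/-! ### Exponential solutions and invariant functions -/

/-- The zeros of the exponent are the frequencies of exponential solutions. -/
theorem HasExponent.integral_exp_mul_adjointOp (h : HasExponent μ ψ) {g : E} (hg : ψ g = 0)
    {φ : E → ℂ} (hφ : ContDiff ℝ (⊤ : ℕ∞) φ) (hc : HasCompactSupport φ) :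
    ∫ x, Complex.exp (Complex.I * (inner ℝ g x : ℝ)) * adjointOp ψ φ x = 0 := by
  set m : E → ℂ := fun ξ => -conj (ψ ((2 * Real.pi) • ξ)) * 𝓕 φ ξ with hm
  have hmi : Integrable m := h.integrable_mul_fourier (hc.toSchwartzMap hφ)
  have hmc : Continuous m := by
    have h1 := h.continuous
    have h2 : Continuous (𝓕 φ) := by
      have := (𝓕 (hc.toSchwartzMap hφ)).continuous
      rwa [SchwartzMap.fourier_coe] at this
    fun_prop
  have hLi : Integrable (𝓕⁻ m) := h.integrable_adjointOp hφ hc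
  have hFi : Integrable (𝓕 m) := by
    refine hLi.comp_neg.congr (.of_forall fun x => ?_)
    simp only [Real.fourierInv_eq_fourier_neg, neg_neg]
  have hinv := congrFun (hmc.fourier_fourierInv_eq hmi hFi) (-((2 * Real.pi)⁻¹ • g))
  have h0 : m (-((2 * Real.pi)⁻¹ • g)) = 0 := by
    simp only [hm]
    rw [smul_neg, smul_smul, mul_inv_cancel₀ (by positivity), one_smul, h.map_neg, hg]
    simp
  rw [h0, Real.fourier_eq'] at hinv
  rw [← hinv]
  refine integral_congr_ae (.of_forall fun x => ?_)
  simp only [smul_eq_mul, adjointOp]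
  congr 2
  rw [inner_neg_right, real_inner_smul_right, real_inner_comm, mul_comm Complex.I]
  congr 2
  field_simp

/-- By Fubini there is a point `x` with `f (x + h) = f x` for almost all `h`. -/
theorem exists_ae_eq_const_of_forall_translate (hf : StronglyMeasurable f)
    (htrans : ∀ h, (fun x => f (x + h)) =ᵐ[volume] f) : ∃ c, f =ᵐ[volume] fun _ => c := by
  have hmeas : MeasurableSet {p : E × E | f (p.2 + p.1) = f p.2} :=
    measurableSet_eq_fun (hf.measurable.comp (measurable_snd.add measurable_fst))
      (hf.measurable.comp measurable_snd)
  have h1 : ∀ᵐ h : E, ∀ᵐ x : E, f (x + h) = f x := .of_forall htrans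
  rw [Measure.ae_ae_comm hmeas] at h1
  obtain ⟨x, hx⟩ := h1.exists
  refine ⟨f x, ?_⟩
  have h2 := (measurePreserving_sub_right (volume : Measure E) x).quasiMeasurePreserving.ae hx
  filter_upwards [h2] with y hy
  simpa using hy

end LevyLiouville

/-! ### The Liouville property and the periods of bounded solutions -/

namespace LevyLiouville

variable {n : ℕ} {ψ : EuclideanSpace ℝ (Fin n) → ℂ}

theorem IsCharExponent.hasExponent {Ω : Type*} [MeasurableSpace Ω] {P : Measure Ω}
    [IsProbabilityMeasure P] {X : ℝ≥0 → Ω → EuclideanSpace ℝ (Fin n)}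
    (hψ : IsCharExponent P X ψ) (hX : ∀ t, Measurable (X t)) :
    HasExponent (fun t => P.map (X t)) ψ where
  isProbabilityMeasure t := Measure.isProbabilityMeasure_map (hX t).aemeasurable
  charFun_eq t ξ := by
    rw [charFun_apply, integral_map (hX t).aemeasurable
      (Continuous.aestronglyMeasurable (by fun_prop)), ← hψ t ξ]
    simp_rw [mul_comm Complex.I, real_inner_comm ξ]

/-- A bounded solution may be modified on a null set to be measurable and bounded everywhere. -/
theorem IsBoundedSolution.exists_stronglyMeasurable {f : EuclideanSpace ℝ (Fin n) → ℂ}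
    (hf : IsBoundedSolution ψ f) :
    ∃ f₀ : EuclideanSpace ℝ (Fin n) → ℂ, ∃ B : ℝ, StronglyMeasurable f₀ ∧ (∀ x, ‖f₀ x‖ ≤ B) ∧
      f =ᵐ[volume] f₀ ∧ ∀ φ : EuclideanSpace ℝ (Fin n) → ℂ, ContDiff ℝ (⊤ : ℕ∞) φ →
        HasCompactSupport φ → ∫ x, f₀ x * adjointOp ψ φ x = 0 := by
  obtain ⟨hmem, hsol⟩ := hf
  set f₁ := hmem.1.mk f with hf₁
  have hf₁m : StronglyMeasurable f₁ := hmem.1.stronglyMeasurable_mk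
  set B := (eLpNorm f ⊤ volume).toReal with hB
  have hbound : ∀ᵐ x, ‖f x‖ ≤ B := by
    filter_upwards [ae_le_eLpNormEssSup (f := f) (μ := volume)] with x hx
    rw [← toReal_enorm, hB]
    refine ENNReal.toReal_mono hmem.2.ne ?_
    rwa [eLpNorm_exponent_top]
  have hset : MeasurableSet {x | ‖f₁ x‖ ≤ B} :=
    measurableSet_le hf₁m.norm.measurable measurable_const
  have hae : f =ᵐ[volume] {x | ‖f₁ x‖ ≤ B}.indicator f₁ := by
    filter_upwards [hmem.1.ae_eq_mk, hbound] with x hx hb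
    rw [Set.indicator_of_mem]
    · exact hx
    · change ‖f₁ x‖ ≤ B
      rw [hx] at hb
      exact hb
  refine ⟨{x | ‖f₁ x‖ ≤ B}.indicator f₁, B, hf₁m.indicator hset, fun x => ?_, hae,
    fun φ hφ hc => ?_⟩
  · by_cases hx : x ∈ {x | ‖f₁ x‖ ≤ B}
    · rw [Set.indicator_of_mem hx]
      exact hx
    · rw [Set.indicator_of_notMem hx, norm_zero]
      exact ENNReal.toReal_nonneg
  · rw [← hsol φ ⟨hφ, hc⟩]
    refine integral_congr_ae ?_
    filter_upwards [hae] with x hx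
    rw [hx]
    rfl

theorem periods_congr {f g : EuclideanSpace ℝ (Fin n) → ℂ} (h : f =ᵐ[volume] g) :
    periods f = periods g := by
  ext a
  have h1 : (fun x => f (x + a)) =ᵐ[volume] fun x => g (x + a) :=
    (measurePreserving_add_right volume a).quasiMeasurePreserving.ae_eq_comp h
  change (fun x => f (x + a)) =ᵐ[volume] f ↔ (fun x => g (x + a)) =ᵐ[volume] g
  exact ⟨fun hf => h1.symm.trans (hf.trans h), fun hg => h1.trans (hg.trans h.symm)⟩

variable {μ : ℝ≥0 → Measure (EuclideanSpace ℝ (Fin n))}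

theorem IsBoundedSolution.orthogonalSubgroup_subset_periods (h : HasExponent μ ψ)
    {f : EuclideanSpace ℝ (Fin n) → ℂ} (hf : IsBoundedSolution ψ f) :
    orthogonalSubgroup (zeroSet ψ) ⊆ periods f := by
  obtain ⟨f₀, B, hm, hB, hae, hsol⟩ := hf.exists_stronglyMeasurable
  intro a ha
  rw [periods_congr hae]
  exact ae_translate_eq_of_mem_translateInvariance hm hB
    (h.mem_translateInvariance hm hB hsol fun g hg => ha g hg)

theorem isBoundedSolution_exp (h : HasExponent μ ψ) {g : EuclideanSpace ℝ (Fin n)}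
    (hg : g ∈ zeroSet ψ) :
    IsBoundedSolution ψ fun x => Complex.exp (Complex.I * (inner ℝ g x : ℝ)) := by
  refine ⟨memLp_top_of_bound (Continuous.aestronglyMeasurable (by fun_prop)) 1
    (.of_forall fun x => ?_), fun φ hφ => h.integral_exp_mul_adjointOp hg hφ.1 hφ.2⟩
  rw [mul_comm, Complex.norm_exp_ofReal_mul_I]

theorem eq_zero_of_forall_exp_inner_eq_one {g : EuclideanSpace ℝ (Fin n)}
    (hg : ∀ x : EuclideanSpace ℝ (Fin n), Complex.exp (Complex.I * (inner ℝ g x : ℝ)) = 1) :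
    g = 0 := by
  by_contra h0
  have h1 := hg ((Real.pi / ‖g‖ ^ 2) • g)
  have h2 : ‖g‖ ^ 2 ≠ 0 := pow_ne_zero _ (norm_ne_zero_iff.2 h0)
  rw [real_inner_smul_right, real_inner_self_eq_norm_sq, div_mul_cancel₀ _ h2, mul_comm,
    Complex.exp_pi_mul_I] at h1
  norm_num at h1

theorem liouvilleProperty_iff (h : HasExponent μ ψ) :
    LiouvilleProperty ψ ↔ zeroSet ψ = {0} := by
  constructor
  · intro hL
    refine Set.eq_singleton_iff_unique_mem.2 ⟨h.map_zero, fun g hg => ?_⟩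
    obtain ⟨c, hc⟩ := hL _ (isBoundedSolution_exp h hg)
    have heq := (Continuous.ae_eq_iff_eq volume (by fun_prop) continuous_const).1 hc
    refine eq_zero_of_forall_exp_inner_eq_one fun x => ?_
    rw [congrFun heq x, ← congrFun heq 0]
    simp
  · intro hZ f hf
    obtain ⟨f₀, B, hm, hB, hae, hsol⟩ := hf.exists_stronglyMeasurable
    obtain ⟨c, hc⟩ := exists_ae_eq_const_of_forall_translate hm fun a => by
      have ha : a ∈ periods f := hf.orthogonalSubgroup_subset_periods h (by
        rw [hZ]
        rintro g rfl
        simp)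
      rwa [periods_congr hae] at ha
    exact ⟨c, hae.trans hc⟩

theorem setOf_forall_mem_periods_eq (h : HasExponent μ ψ) :
    {a | ∀ f, IsBoundedSolution ψ f → a ∈ periods f} = orthogonalSubgroup (zeroSet ψ) := by
  refine Set.Subset.antisymm (fun a ha g hg => ?_)
    fun a ha f hf => hf.orthogonalSubgroup_subset_periods h ha
  have heq := congrFun ((Continuous.ae_eq_iff_eq volume (by fun_prop) (by fun_prop)).1
    (ha _ (isBoundedSolution_exp h hg))) 0
  simpa [real_inner_comm] using heq

end LevyLiouville

theorem mainTheorem1 {n : ℕ} {Ω : Type*} [MeasurableSpace Ω] (P : Measure Ω)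
    [IsProbabilityMeasure P] (X : ℝ≥0 → Ω → EuclideanSpace ℝ (Fin n))
    (hX : LevyLiouville.IsLevyProcess P X)
    (ψ : EuclideanSpace ℝ (Fin n) → ℂ) (hψ : LevyLiouville.IsCharExponent P X ψ) :
    (LevyLiouville.LiouvilleProperty ψ ↔ LevyLiouville.zeroSet ψ = {0}) ∧
      (LevyLiouville.zeroSet ψ ≠ {0} →
        (∀ f, LevyLiouville.IsBoundedSolution ψ f →
          LevyLiouville.orthogonalSubgroup (LevyLiouville.zeroSet ψ) ⊆
            LevyLiouville.periods f) ∧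
        {h | ∀ f, LevyLiouville.IsBoundedSolution ψ f → h ∈ LevyLiouville.periods f} =
          LevyLiouville.orthogonalSubgroup (LevyLiouville.zeroSet ψ)) := by
  have h := hψ.hasExponent hX.measurable
  exact ⟨LevyLiouville.liouvilleProperty_iff h, fun _ =>
    ⟨fun f hf => hf.orthogonalSubgroup_subset_periods h,
      LevyLiouville.setOf_forall_mem_periods_eq h⟩⟩
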